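/- Fix a real number $\eta\neq 0$. Write $z_i=\partial_x^i u$, let $U\subset\mathbb{R}^3$ be a nonempty connected open set of jets $(z_0,z_1,z_2)=(u,u_x,u_{xx})$, and let $F$ and $f_{ij}$ ($1\le i\le 3$, $1\le j\le 2$) be smooth functions of $(z_0,z_1,z_2)$ on $U$, where $u_t=F(u,u_x,u_{xx})$ is of second order, i.e. $F_{z_2}\ne 0$ on $U$. Put $\omega^i=f_{i1}\,dx+f_{i2}\,dt$. The equation *describes $\eta$ pseudo-spherical surfaces with associated forms* $\omega^i$ if $f_{21}=\eta$, if $\omega^1\wedge\omega^2\neq 0$ on a dense subset of $U$, and if for every smooth function $u(x,t)$ and every point at which the 2-jet of $u$ lies in $U$ the structure equations $d\omega^1=\omega^3\wedge\omega^2$, $d\omega^2=\omega^1\wedge\omega^3$, $d\omega^3=\omega^1\wedge\omega^2$ hold at that point if and only if $u_t=F(u,u_x,u_{xx})$ holds there. We say that *the second fundamental form coefficients of local isometric immersions in $\mathbb{R}^3$ of the surfaces determined by the solutions depend on a jet of finite order of $u$* if there are smooth functions $a,b,c$ of $(x,t,z_0,\dots,z_\ell)$, for some finite $\ell\ge 2$,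 on a nonempty connected open set $W$ of points with $(z_0,z_1,z_2)\in U$, such that the forms $\omega^3_1=a\omega^1+b\omega^2$, $\omega^3_2=b\omega^1+c\omega^2$ satisfy the Gauss and Codazzi equations $$ac-b^2=-1,\qquad d\omega^3_1=-\omega^3_2\wedge\omega^2_1,\qquad d\omega^3_2=-\omega^3_1\wedge\omega^1_2,\qquad \omega^2_1=-\omega^1_2=\omega^3,$$ along the solutions, i.e. identically in the jet variables, where $d$ is computed with the total derivatives $D_x$ and $D_t$, and $D_t$ uses $z_{i,t}=D_x^iF$. (A dependence on a jet of order less than $2$ is the special case in which $a,b,c$ do not depend on all of these variables.) Theorem. (1) If the equation describes $\eta$ pseudo-spherical surfaces with associated forms $\omega^i$, and if such functions $a,b,c$ exist for some finite $\ell$ and some $W$, then, for one choice of the sign and one constant $\lambda$, everywhere on $U$, $$f_{31}=\pm f_{11},\qquad f_{32}=\pm f_{12},\qquad f_{22}=\lambda,\qquad f_{21}=\eta,$$ $f_{11}$ has vanishing derivatives with respect to $z_1,z_2$, $f_{12}$ has vanishing derivative with respect to $z_2$, $f_{11,u}\neq0$, $f_{12,u_x}\ne 0$, and the equation is $$u_t=\frac{f_{12,u_x}}{f_{11,u}}u_{xx}+\frac{f_{12,u}}{f_{11,u}}u_x\mp\frac{\lambda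 f_{11}-\eta f_{12}}{f_{11,u}}.\qquad(*)$$ (2) Conversely, if $F$ and the $f_{ij}$ have the form described in (1), then the equation describes $\eta$ pseudo-spherical surfaces with associated forms $\omega^i$, and for every $(x,t)\in\mathbb{R}^2$ and $(z_0,z_1,z_2)\in U$ there are functions $a,b,c$ as above, with $\ell=2$, on some $W$ containing $(x,t,z_0,z_1,z_2)$. (3) If $F$ and the $f_{ij}$ have the form described in (1), then for every $\ell$ and every $W$ all such $a,b,c$ are universal: on $W$ they are functions of $x$ and $t$ only, independent of $u$ and its derivatives. -/

import Mathlib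

open scoped ContDiff

noncomputable section

namespace PseudoSpherical

/-- The spatial 2-jet `(z₀, z₁, z₂) = (u, u_x, u_xx)` of a function `u = u(x, t)`. -/
def spaceJet (u : ℝ → ℝ → ℝ) (x t : ℝ) : Fin 3 → ℝ :=
  fun i => iteratedDeriv i (fun y => u y t) x

/-- Partial derivative `∂g/∂z_k` of a function of `(z₀, z₁, z₂)`. -/
def pd (k : Fin 3) (g : (Fin 3 → ℝ) → ℝ) (z : Fin 3 → ℝ) : ℝ :=
  fderiv ℝ g z (Pi.single k 1)

/-- Coefficient of `dx ∧ dt` in `(p dx + q dt) ∧ (p' dx + q' dt)`. -/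
def wedge (p q p' q' : ℝ) : ℝ := p * q' - q * p'

/-- Coefficient of `dx ∧ dt` in `d (P dx + Q dt)`, for functions `P, Q` of `(x, t)`. -/
def extD (P Q : ℝ → ℝ → ℝ) (x t : ℝ) : ℝ :=
  deriv (fun y => Q y t) x - deriv (fun s => P x s) t

/-- The coefficients of the three 1-forms `ωⁱ = f_{i1} dx + f_{i2} dt`; `f i j` is `f_{i+1, j+1}`
since indices start at `0`. They are functions of `(z₀, z₁, z₂) = (u, u_x, u_xx)`. -/
abbrev Coeffs := Fin 3 → Fin 2 → (Fin 3 → ℝ) → ℝ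

/-- The coefficient of `dx ∧ dt` in `ω¹ ∧ ω²`. -/
def area (f : Coeffs) (z : Fin 3 → ℝ) : ℝ :=
  wedge (f 0 0 z) (f 0 1 z) (f 1 0 z) (f 1 1 z)

/-- The structure equations `dω¹ = ω³ ∧ ω²`, `dω² = ω¹ ∧ ω³`, `dω³ = ω¹ ∧ ω²` at the point
`(x, t)`, for the 1-forms obtained by substituting the function `u` in the `f_{ij}`. -/
def StructureAt (f : Coeffs) (u : ℝ → ℝ → ℝ) (x t : ℝ) : Prop :=
  let θ : Fin 3 → Fin 2 → ℝ → ℝ → ℝ := fun i j y s => f i j (spaceJet u y s)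
  extD (θ 0 0) (θ 0 1) x t = wedge (θ 2 0 x t) (θ 2 1 x t) (θ 1 0 x t) (θ 1 1 x t) ∧
  extD (θ 1 0) (θ 1 1) x t = wedge (θ 0 0 x t) (θ 0 1 x t) (θ 2 0 x t) (θ 2 1 x t) ∧
  extD (θ 2 0) (θ 2 1) x t = wedge (θ 0 0 x t) (θ 0 1 x t) (θ 1 0 x t) (θ 1 1 x t)

/-- The equation `u_t = F(u, u_x, u_xx)`, with `F` defined on the set `U` of 2-jets, describes
`η` pseudo-spherical surfaces with associated 1-forms `ωⁱ = f_{i1} dx + f_{i2} dt`: `f₂₁ = η`,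
`ω¹ ∧ ω² ≠ 0` generically, and the structure equations are equivalent to the evolution equation
(pointwise, at every point where the jet of `u` lies in `U`). -/
def DescribesPSS (η : ℝ) (U : Set (Fin 3 → ℝ)) (f : Coeffs) (F : (Fin 3 → ℝ) → ℝ) : Prop :=
  (∀ z ∈ U, f 1 0 z = η) ∧
  U ⊆ closure {z | z ∈ U ∧ area f z ≠ 0} ∧
  ∀ u : ℝ → ℝ → ℝ, ContDiff ℝ ∞ (fun p : ℝ × ℝ => u p.1 p.2) →
    ∀ x t : ℝ, spaceJet u x t ∈ U →
      (StructureAt f u x t ↔ deriv (fun s => u x s) t = F (spaceJet u x t))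

/-- Total `x`-derivative of a function of `(z₀, …, z_{n-1})`, as a function of `(z₀, …, z_n)`:
`∑ₖ (∂G/∂z_k) z_{k+1}`. -/
def totalX {n : ℕ} (G : (Fin n → ℝ) → ℝ) (z : Fin (n + 1) → ℝ) : ℝ :=
  fderiv ℝ G (fun k => z k.castSucc) (fun k => z k.succ)

/-- `z_{i,t} = D_xⁱ F`, the time derivative of `z_i` along solutions of `u_t = F(u, u_x, u_xx)`,
as a function of `(z₀, …, z_{i+2})`. -/
def timeDer (F : (Fin 3 → ℝ) → ℝ) : (i : ℕ) → (Fin (3 + i) → ℝ) → ℝ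
  | 0 => F
  | i + 1 => totalX (timeDer F i)

/-- Points `(x, t, z₀, …, z_{m+2})`: spatial jets of order `m + 2`. -/
abbrev JetSpace (m : ℕ) := ℝ × ℝ × (Fin (3 + m) → ℝ)

/-- The first `n` coordinates of an infinite spatial jet `(z₀, z₁, z₂, …)`. -/
def res (n : ℕ) (z : ℕ → ℝ) : Fin n → ℝ := fun k => z k

/-- The 2-jet `(z₀, z₁, z₂)` underlying a jet of order `m + 2`. -/
def base {m : ℕ} (q : JetSpace m) : Fin 3 → ℝ := fun k => q.2.2 (Fin.castAdd m k)

/-- Total derivative `D_x Φ = Φ_x + ∑ᵢ Φ_{z_i} z_{i+1}`. -/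
def Dx {m : ℕ} (Φ : JetSpace m → ℝ) (x t : ℝ) (z : ℕ → ℝ) : ℝ :=
  fderiv ℝ Φ (x, t, res (3 + m) z) (1, 0, fun k => z (k + 1))

/-- Total derivative `D_t Φ = Φ_t + ∑ᵢ Φ_{z_i} z_{i,t}` along solutions of the equation, that is,
with `z_{i,t} = D_xⁱ F`. -/
def Dt (F : (Fin 3 → ℝ) → ℝ) {m : ℕ} (Φ : JetSpace m → ℝ) (x t : ℝ) (z : ℕ → ℝ) : ℝ :=
  fderiv ℝ Φ (x, t, res (3 + m) z) (0, 1, fun k => timeDer F k (res (3 + k) z))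

/-- Coefficient of `dx ∧ dt` in `d (P dx + Q dt)` along solutions of the equation. -/
def totalD (F : (Fin 3 → ℝ) → ℝ) {m : ℕ} (P Q : JetSpace m → ℝ) (x t : ℝ) (z : ℕ → ℝ) : ℝ :=
  Dx Q x t z - Dt F P x t z

/-- `a, b, c` are smooth functions of a jet `(x, t, z₀, …, z_{m+2})` of finite order, defined on
the domain (connected open set) `W` of jet space, that are the coefficients of the second
fundamental forms of local isometric immersions in `ℝ³` of the surfaces determined by the solutions
of the equation: with `ω³₁ = a ω¹ + b ω²`, `ω³₂ = b ω¹ + c ω²` and `ω²₁ = -ω¹₂ = ω³`, the Gauss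
equation `a c - b² = -1` and the Codazzi equations `dω³₁ = -ω³₂ ∧ ω²₁`, `dω³₂ = -ω³₁ ∧ ω¹₂`
hold along solutions. A function of a jet of order less than `2` is in particular one of a jet of
order `2`. -/
structure IsSecondFundamentalForm (U : Set (Fin 3 → ℝ)) (f : Coeffs) (F : (Fin 3 → ℝ) → ℝ)
    {m : ℕ} (W : Set (JetSpace m)) (a b c : JetSpace m → ℝ) : Prop where
  isOpen : IsOpen W
  isConnected : IsConnected W
  base_mem : ∀ q ∈ W, base q ∈ U
  smooth_a : ContDiffOn ℝ ∞ a W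
  smooth_b : ContDiffOn ℝ ∞ b W
  smooth_c : ContDiffOn ℝ ∞ c W
  gauss : ∀ q ∈ W, a q * c q - b q ^ 2 = -1
  codazzi₁ : ∀ (x t : ℝ) (z : ℕ → ℝ), (x, t, res (3 + m) z) ∈ W →
    let q : JetSpace m := (x, t, res (3 + m) z)
    totalD F (fun p => a p * f 0 0 (base p) + b p * f 1 0 (base p))
        (fun p => a p * f 0 1 (base p) + b p * f 1 1 (base p)) x t z
      = - wedge (b q * f 0 0 (base q) + c q * f 1 0 (base q))
          (b q * f 0 1 (base q) + c q * f 1 1 (base q))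
          (f 2 0 (base q)) (f 2 1 (base q))
  codazzi₂ : ∀ (x t : ℝ) (z : ℕ → ℝ), (x, t, res (3 + m) z) ∈ W →
    let q : JetSpace m := (x, t, res (3 + m) z)
    totalD F (fun p => b p * f 0 0 (base p) + c p * f 1 0 (base p))
        (fun p => b p * f 0 1 (base p) + c p * f 1 1 (base p)) x t z
      = - wedge (a q * f 0 0 (base q) + b q * f 1 0 (base q))
          (a q * f 0 1 (base q) + b q * f 1 1 (base q))
          (-(f 2 0 (base q))) (-(f 2 1 (base q)))

/-- The functions `a, b, c` on `W` are universal: functions of `x` and `t` only. -/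
def IsUniversal {m : ℕ} (W : Set (JetSpace m)) (a b c : JetSpace m → ℝ) : Prop :=
  ∃ A B C : ℝ → ℝ → ℝ, ∀ q ∈ W,
    a q = A q.1 q.2.1 ∧ b q = B q.1 q.2.1 ∧ c q = C q.1 q.2.1

/-- The exceptional equations
`u_t = (f₁₂,₁ u_xx + f₁₂,₀ u_x ∓ (λ f₁₁ - η f₁₂)) / f₁₁,₀` (where `,k` is `∂/∂z_k`), with
`f₁₁ = f₁₁(u)`, `f₁₂ = f₁₂(u, u_x)`, `f₂₁ = η`, `f₂₂ = λ` constant, `f₃₁ = ± f₁₁`,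
`f₃₂ = ± f₁₂`, `f₁₁,₀ ≠ 0` and `f₁₂,₁ ≠ 0`; `ε` is the sign `±`. -/
def IsExceptional (η : ℝ) (U : Set (Fin 3 → ℝ)) (f : Coeffs) (F : (Fin 3 → ℝ) → ℝ) : Prop :=
  ∃ ε lam : ℝ, (ε = 1 ∨ ε = -1) ∧ ∀ z ∈ U,
    f 1 0 z = η ∧ f 1 1 z = lam ∧ f 2 0 z = ε * f 0 0 z ∧ f 2 1 z = ε * f 0 1 z ∧
    pd 1 (f 0 0) z = 0 ∧ pd 2 (f 0 0) z = 0 ∧ pd 2 (f 0 1) z = 0 ∧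
    pd 0 (f 0 0) z ≠ 0 ∧ pd 1 (f 0 1) z ≠ 0 ∧
    F z = pd 1 (f 0 1) z / pd 0 (f 0 0) z * z 2 + pd 0 (f 0 1) z / pd 0 (f 0 0) z * z 1
      - ε * ((lam * f 0 0 z - η * f 0 1 z) / pd 0 (f 0 0) z)

end PseudoSpherical

end

/-! Write ' for ∂/∂z₀, G for F_{z₂}, and L = f₁₁f₃₁' − f₃₁f₁₁'.

At a point, the spatial 3-jet of u and the t-derivative of its 2-jet can be prescribed
independently. Hence the structure equations for arbitrary u split into identities on U
(`StructureIdentities`): locally f_{i1} depends on z₀ only and f_{i2} on z₀, z₁, and G links f₁₂,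
f₃₂ to f₁₁', f₃₁'. Repeated z₁-derivatives of these identities force f₁₁'f₃₁'' = f₃₁'f₁₁''
(`StructureIdentities.wronskian_eq_zero`), so the direction of (f₁₁', f₃₁') is locally constant.

The coefficients a, b, c have no derivatives in the jet variables (`vert_eq_zero`). If z_k is the
highest variable present, the z_{k+2}-derivative of the Codazzi equations sees only the D_t terms.
Together with the derivative of the Gauss equation it shows that ∂a/∂z_k ≠ 0 forces the second
fundamental form to vanish on ∂_x. In that case b and c are determined by a up to a sign, and the
Codazzi equations force ω¹ ∧ ω² = 0 wherever ∂a/∂z_k ≠ 0, against density.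

The z₁-derivatives of the Codazzi equations are then relations between 2b, a − c and the
x-derivatives of a, b. As ac − b² = −1 excludes umbilics, (2b, a − c) never vanishes, and this
forces f₁₁' ≠ 0 (`pd0_f11_ne`) and L = 0 (`IsSecondFundamentalForm.wronskian_eq_zero`) below W. So
f₃₁ = k f₁₁ near a suitable point, and eliminating F gives k² = 1 (`exists_sign`). Constancy of the
direction of (f₁₁', f₃₁') carries this from the projection of W to all of the connected set U
(`f31_eq`), and (*) follows.

For the exceptional equations ω² = dθ with θ = ηx + λt, and the Gauss–Codazzi system reduces to
ordinary differential equations in θ with two explicit first integrals. Solving them gives both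
existence and universality. -/

open Filter Topology

noncomputable section

namespace PseudoSpherical

/-! ### Calculus: differentiating identities along coordinate lines. -/

section

section Calculus

variable {E : Type*} [NormedAddCommGroup E] [NormedSpace ℝ E] {S : Set E} {g : E → ℝ}

lemma differentiableAt_of_smooth (hS : IsOpen S) (hg : ContDiffOn ℝ ∞ g S) {q : E} (hq : q ∈ S) :
    DifferentiableAt ℝ g q :=
  (hg.contDiffAt (hS.mem_nhds hq)).differentiableAt (by simp)

lemma contDiffOn_fderiv_apply (hS : IsOpen S) (hg : ContDiffOn ℝ ∞ g S) (v : E) :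
    ContDiffOn ℝ ∞ (fun q => fderiv ℝ g q v) S :=
  (hg.fderiv_of_isOpen hS (m := ∞) (by simp)).clm_apply contDiffOn_const

lemma fderiv_fderiv_comm (hS : IsOpen S) (hg : ContDiffOn ℝ ∞ g S) {q : E} (hq : q ∈ S) (v w : E) :
    fderiv ℝ (fun p => fderiv ℝ g p w) q v = fderiv ℝ (fun p => fderiv ℝ g p v) q w := by
  have hd : DifferentiableAt ℝ (fderiv ℝ g) q :=
    ((hg.fderiv_of_isOpen hS (m := ∞) (by simp)).contDiffAt (hS.mem_nhds hq)).differentiableAt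
      (by simp)
  have hs := (hg.contDiffAt (hS.mem_nhds hq)).isSymmSndFDerivAt
    (by rw [minSmoothness_of_isRCLikeNormedField]; exact WithTop.coe_le_coe.2 le_top)
  have h (u : E) : fderiv ℝ (fun p => fderiv ℝ g p u) q = (fderiv ℝ (fderiv ℝ g) q).flip u := by
    rw [fderiv_clm_apply hd (differentiableAt_const _)]
    ext; simp
  rw [h, h]
  exact hs v w

lemma fderiv_eq_zero_of_eqOn_const (hS : IsOpen S) {c : ℝ} (hg : ∀ q ∈ S, g q = c) {q : E}
    (hq : q ∈ S) : fderiv ℝ g q = 0 := by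
  have : g =ᶠ[𝓝 q] fun _ => c := by
    filter_upwards [hS.mem_nhds hq] with p hp using hg p hp
  rw [this.fderiv_eq]
  simp

/-- If a directional derivative of `g` vanishes on an open set, then so do its mixed derivatives. -/
lemma fderiv_fderiv_eq_zero (hS : IsOpen S) (hg : ContDiffOn ℝ ∞ g S) {v : E}
    (h0 : ∀ q ∈ S, fderiv ℝ g q v = 0) {q : E} (hq : q ∈ S) (w : E) :
    fderiv ℝ (fun p => fderiv ℝ g p w) q v = 0 := by
  rw [fderiv_fderiv_comm hS hg hq, fderiv_eq_zero_of_eqOn_const hS h0 hq]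
  rfl

lemma hasDerivAt_comp_add_smul (hS : IsOpen S) (hg : ContDiffOn ℝ ∞ g S) {q : E} (hq : q ∈ S)
    (v : E) : HasDerivAt (fun s : ℝ => g (q + s • v)) (fderiv ℝ g q v) 0 := by
  have h := (differentiableAt_of_smooth hS hg hq).hasFDerivAt
  have h2 : HasDerivAt (fun s : ℝ => q + s • v) v 0 := by
    simpa using ((hasDerivAt_id (0 : ℝ)).smul_const v).const_add q
  have h3 : HasFDerivAt g (fderiv ℝ g q) (q + (0 : ℝ) • v) := by simpa using h
  exact h3.comp_hasDerivAt 0 h2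

end Calculus

section Base

/-- The coordinate line through `z` in direction `k`. -/
def line {ι : Type*} [DecidableEq ι] (k : ι) (z : ι → ℝ) (s : ℝ) : ι → ℝ := z + s • Pi.single k 1

@[simp] lemma line_zero {ι : Type*} [DecidableEq ι] (k : ι) (z : ι → ℝ) : line k z 0 = z := by
  simp [line]

lemma hasDerivAt_line_apply {ι : Type*} [DecidableEq ι] (k : ι) (z : ι → ℝ) (j : ι) :
    HasDerivAt (fun s => line k z s j) (if j = k then 1 else 0) 0 := by
  have := ((hasDerivAt_id (0 : ℝ)).mul_const ((Pi.single k 1 : ι → ℝ) j)).const_add (z j)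
  simpa [line, Pi.single_apply] using this

lemma eventually_line_mem {ι : Type*} [DecidableEq ι] {U : Set (ι → ℝ)}
    (hU : IsOpen U) (k : ι) {z : ι → ℝ} (hz : z ∈ U) : ∀ᶠ s in 𝓝 (0 : ℝ), line k z s ∈ U := by
  have hc : Continuous (line k z) := by unfold line; fun_prop
  exact hc.continuousAt.eventually_mem (by simpa using hU.mem_nhds hz)

variable {U : Set (Fin 3 → ℝ)} {g h : (Fin 3 → ℝ) → ℝ} {z : Fin 3 → ℝ}

lemma contDiffOn_pd (hU : IsOpen U) (hg : ContDiffOn ℝ ∞ g U) (k : Fin 3) :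
    ContDiffOn ℝ ∞ (pd k g) U := contDiffOn_fderiv_apply hU hg _

lemma pd_comm (hU : IsOpen U) (hg : ContDiffOn ℝ ∞ g U) (hz : z ∈ U) (j k : Fin 3) :
    pd j (pd k g) z = pd k (pd j g) z := fderiv_fderiv_comm hU hg hz _ _

lemma pd_eq_zero_of_eqOn_const (hU : IsOpen U) {c : ℝ} (hg : ∀ w ∈ U, g w = c) (hz : z ∈ U)
    (k : Fin 3) : pd k g z = 0 := by
  simp [pd, fderiv_eq_zero_of_eqOn_const hU hg hz]

lemma pd_pd_eq_zero (hU : IsOpen U) (hg : ContDiffOn ℝ ∞ g U) {k : Fin 3}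
    (h0 : ∀ w ∈ U, pd k g w = 0) (hz : z ∈ U) (j : Fin 3) : pd k (pd j g) z = 0 :=
  fderiv_fderiv_eq_zero hU hg h0 hz _

lemma hasDerivAt_line (hU : IsOpen U) (hg : ContDiffOn ℝ ∞ g U) (hz : z ∈ U) (k : Fin 3) :
    HasDerivAt (fun s => g (line k z s)) (pd k g z) 0 :=
  hasDerivAt_comp_add_smul hU hg hz _

/-- The device for differentiating an identity valid on U in the direction z_k: the `HasDerivAt`
terms for the two sides are assembled by hand and their values compared. -/
lemma deriv_eq_of_line {k : Fin 3} (hU : IsOpen U) (hz : z ∈ U) {φ ψ : ℝ → ℝ} {a b : ℝ}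
    (hφ : HasDerivAt φ a 0) (hψ : HasDerivAt ψ b 0) (he : ∀ s, line k z s ∈ U → φ s = ψ s) :
    a = b :=
  hφ.unique (hψ.congr_of_eventuallyEq ((eventually_line_mem hU k hz).mono he))

lemma fderiv_apply_eq_sum (g : (Fin 3 → ℝ) → ℝ) (z v : Fin 3 → ℝ) :
    fderiv ℝ g z v = v 0 * pd 0 g z + v 1 * pd 1 g z + v 2 * pd 2 g z := by
  have hv : v = v 0 • Pi.single 0 1 + v 1 • Pi.single 1 1 + v 2 • Pi.single 2 1 := by
    ext i; fin_cases i <;> simp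
  conv_lhs => rw [hv]
  simp [pd]

lemma eq_of_pd_eq_zero (hU : IsOpen U) (hUc : IsConnected U) (hg : ContDiffOn ℝ ∞ g U)
    (h0 : ∀ k, ∀ w ∈ U, pd k g w = 0) {w : Fin 3 → ℝ} (hz : z ∈ U) (hw : w ∈ U) : g z = g w := by
  refine hU.is_const_of_fderiv_eq_zero (𝕜 := ℝ) hUc.isPreconnected
    (fun p hp => (differentiableAt_of_smooth hU hg hp).differentiableWithinAt) ?_ hz hw
  intro p hp
  ext v
  simp [fderiv_apply_eq_sum, h0 _ p hp]

/-- A smooth function with a nonvanishing partial derivative is nonzero somewhere on any open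
set. -/
lemma exists_ne_zero_of_pd_ne_zero (hU : IsOpen U) (hz : z ∈ U) (k : Fin 3) (h0 : pd k g z ≠ 0) :
    ∃ w ∈ U, g w ≠ 0 := by
  by_contra! h
  exact h0 (pd_eq_zero_of_eqOn_const hU h hz k)

end Base

end

/-! ### Consequences of the structure equations for the functions f_{ij} and F. -/

section

/-- The differential identities on the functions `f_{ij}` that are equivalent to the structure
equations along the solutions of `u_t = F`. -/
structure StructureIdentities (η : ℝ) (U : Set (Fin 3 → ℝ)) (f : Coeffs) (F : (Fin 3 → ℝ) → ℝ) :
    Prop where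
  isOpen : IsOpen U
  smooth_F : ContDiffOn ℝ ∞ F U
  smooth : ∀ i j, ContDiffOn ℝ ∞ (f i j) U
  pd_F_ne : ∀ z ∈ U, pd 2 F z ≠ 0
  f21 : ∀ z ∈ U, f 1 0 z = η
  dense : U ⊆ closure {z | z ∈ U ∧ area f z ≠ 0}
  pd1_dx : ∀ i, ∀ z ∈ U, pd 1 (f i 0) z = 0
  pd2_dx : ∀ i, ∀ z ∈ U, pd 2 (f i 0) z = 0
  pd2_dt : ∀ i, ∀ z ∈ U, pd 2 (f i 1) z = 0
  eq₁ : ∀ z ∈ U, pd 0 (f 0 1) z * z 1 + pd 1 (f 0 1) z * z 2 - pd 0 (f 0 0) z * F z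
    = f 2 0 z * f 1 1 z - f 2 1 z * η
  eq₂ : ∀ z ∈ U, pd 0 (f 1 1) z * z 1 + pd 1 (f 1 1) z * z 2
    = f 0 0 z * f 2 1 z - f 0 1 z * f 2 0 z
  eq₃ : ∀ z ∈ U, pd 0 (f 2 1) z * z 1 + pd 1 (f 2 1) z * z 2 - pd 0 (f 2 0) z * F z
    = f 0 0 z * f 1 1 z - f 0 1 z * η
  nondeg : ∀ z ∈ U, pd 0 (f 0 0) z ≠ 0 ∨ pd 0 (f 2 0) z ≠ 0

namespace StructureIdentities

variable {η : ℝ} {U : Set (Fin 3 → ℝ)} {f : Coeffs} {F : (Fin 3 → ℝ) → ℝ} {z : Fin 3 → ℝ}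

lemma line_f (S : StructureIdentities η U f F) (i : Fin 3) (j : Fin 2) (k : Fin 3) (hz : z ∈ U) :
    HasDerivAt (fun s => f i j (line k z s)) (pd k (f i j) z) 0 :=
  hasDerivAt_line S.isOpen (S.smooth i j) hz k

lemma line_pd (S : StructureIdentities η U f F) (i : Fin 3) (j : Fin 2) (l k : Fin 3)
    (hz : z ∈ U) :
    HasDerivAt (fun s => pd l (f i j) (line k z s)) (pd k (pd l (f i j)) z) 0 :=
  hasDerivAt_line S.isOpen (contDiffOn_pd S.isOpen (S.smooth i j) l) hz k

lemma line_F (S : StructureIdentities η U f F) (k : Fin 3) (hz : z ∈ U) :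
    HasDerivAt (fun s => F (line k z s)) (pd k F z) 0 :=
  hasDerivAt_line S.isOpen S.smooth_F hz k

lemma line_pd2F (S : StructureIdentities η U f F) (k : Fin 3) (hz : z ∈ U) :
    HasDerivAt (fun s => pd 2 F (line k z s)) (pd k (pd 2 F) z) 0 :=
  hasDerivAt_line S.isOpen (contDiffOn_pd S.isOpen S.smooth_F 2) hz k

lemma pd2_pd_dt (S : StructureIdentities η U f F) (i l : Fin 3) (hz : z ∈ U) :
    pd 2 (pd l (f i 1)) z = 0 :=
  pd_pd_eq_zero S.isOpen (S.smooth i 1) (S.pd2_dt i) hz l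

lemma pd2_pd_dx (S : StructureIdentities η U f F) (i l : Fin 3) (hz : z ∈ U) :
    pd 2 (pd l (f i 0)) z = 0 :=
  pd_pd_eq_zero S.isOpen (S.smooth i 0) (S.pd2_dx i) hz l

lemma pd1_pd_dx (S : StructureIdentities η U f F) (i l : Fin 3) (hz : z ∈ U) :
    pd 1 (pd l (f i 0)) z = 0 :=
  pd_pd_eq_zero S.isOpen (S.smooth i 0) (S.pd1_dx i) hz l

/-- The z₂-derivative of `eq₁`: only the explicit z₂ and F depend on z₂. -/
lemma pd1_f12 (S : StructureIdentities η U f F) (hz : z ∈ U) :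
    pd 1 (f 0 1) z = pd 0 (f 0 0) z * pd 2 F z := by
  have h := deriv_eq_of_line (k := 2) S.isOpen hz
    ((((S.line_pd 0 1 0 2 hz).fun_mul (hasDerivAt_line_apply 2 z 1)).fun_add
      ((S.line_pd 0 1 1 2 hz).fun_mul (hasDerivAt_line_apply 2 z 2))).fun_sub
      ((S.line_pd 0 0 0 2 hz).fun_mul (S.line_F 2 hz)))
    (((S.line_f 2 0 2 hz).fun_mul (S.line_f 1 1 2 hz)).fun_sub
      ((S.line_f 2 1 2 hz).mul_const η)) (fun s hs => S.eq₁ _ hs)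
  simp [S.pd2_pd_dt _ _ hz, S.pd2_pd_dx _ _ hz, S.pd2_dt _ _ hz, S.pd2_dx _ _ hz] at h
  linarith

lemma pd1_f32 (S : StructureIdentities η U f F) (hz : z ∈ U) :
    pd 1 (f 2 1) z = pd 0 (f 2 0) z * pd 2 F z := by
  have h := deriv_eq_of_line (k := 2) S.isOpen hz
    ((((S.line_pd 2 1 0 2 hz).fun_mul (hasDerivAt_line_apply 2 z 1)).fun_add
      ((S.line_pd 2 1 1 2 hz).fun_mul (hasDerivAt_line_apply 2 z 2))).fun_sub
      ((S.line_pd 2 0 0 2 hz).fun_mul (S.line_F 2 hz)))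
    (((S.line_f 0 0 2 hz).fun_mul (S.line_f 1 1 2 hz)).fun_sub
      ((S.line_f 0 1 2 hz).mul_const η)) (fun s hs => S.eq₃ _ hs)
  simp [S.pd2_pd_dt _ _ hz, S.pd2_pd_dx _ _ hz, S.pd2_dt _ _ hz, S.pd2_dx _ _ hz] at h
  linarith

lemma pd1_f22 (S : StructureIdentities η U f F) (hz : z ∈ U) : pd 1 (f 1 1) z = 0 := by
  have h := deriv_eq_of_line (k := 2) S.isOpen hz
    (((S.line_pd 1 1 0 2 hz).fun_mul (hasDerivAt_line_apply 2 z 1)).fun_add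
      ((S.line_pd 1 1 1 2 hz).fun_mul (hasDerivAt_line_apply 2 z 2)))
    (((S.line_f 0 0 2 hz).fun_mul (S.line_f 2 1 2 hz)).fun_sub
      ((S.line_f 0 1 2 hz).fun_mul (S.line_f 2 0 2 hz))) (fun s hs => S.eq₂ _ hs)
  simpa [S.pd2_pd_dt _ _ hz, S.pd2_pd_dx _ _ hz, S.pd2_dt _ _ hz, S.pd2_dx _ _ hz] using h

lemma pd1_pd_f22 (S : StructureIdentities η U f F) (l : Fin 3) (hz : z ∈ U) :
    pd 1 (pd l (f 1 1)) z = 0 :=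
  pd_pd_eq_zero S.isOpen (S.smooth 1 1) (fun _ h => S.pd1_f22 h) hz l

lemma pd0_f22_mul (S : StructureIdentities η U f F) (hz : z ∈ U) :
    pd 0 (f 1 1) z * z 1 = f 0 0 z * f 2 1 z - f 0 1 z * f 2 0 z := by
  simpa [S.pd1_f22 hz] using S.eq₂ z hz

/-- The z₁-derivative of `pd0_f22_mul`, whose left side is linear in z₁. The right side is G·L. -/
lemma pd0_f22 (S : StructureIdentities η U f F) (hz : z ∈ U) :
    pd 0 (f 1 1) z
      = pd 2 F z * (f 0 0 z * pd 0 (f 2 0) z - f 2 0 z * pd 0 (f 0 0) z) := by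
  have h := deriv_eq_of_line (k := 1) S.isOpen hz
    ((S.line_pd 1 1 0 1 hz).fun_mul (hasDerivAt_line_apply 1 z 1))
    (((S.line_f 0 0 1 hz).fun_mul (S.line_f 2 1 1 hz)).fun_sub
      ((S.line_f 0 1 1 hz).fun_mul (S.line_f 2 0 1 hz))) (fun s hs => S.pd0_f22_mul hs)
  simp [S.pd1_pd_f22 _ hz, S.pd1_dx _ _ hz, S.pd1_f32 hz, S.pd1_f12 hz] at h
  linarith

/-- In `pd0_f22` both f₂₂' and L are independent of z₁, so only G is differentiated. -/
lemma pd1_pd2F_mul (S : StructureIdentities η U f F) (hz : z ∈ U) :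
    pd 1 (pd 2 F) z * (f 0 0 z * pd 0 (f 2 0) z - f 2 0 z * pd 0 (f 0 0) z) = 0 := by
  have h := deriv_eq_of_line (k := 1) S.isOpen hz
    (S.line_pd 1 1 0 1 hz)
    ((S.line_pd2F 1 hz).fun_mul (((S.line_f 0 0 1 hz).fun_mul (S.line_pd 2 0 0 1 hz)).fun_sub
      ((S.line_f 2 0 1 hz).fun_mul (S.line_pd 0 0 0 1 hz)))) (fun s hs => S.pd0_f22 hs)
  simp [S.pd1_pd_f22 _ hz, S.pd1_dx _ _ hz, S.pd1_pd_dx _ _ hz] at h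
  simpa using h

lemma pd1_pd0_f12 (S : StructureIdentities η U f F) (hz : z ∈ U) :
    pd 1 (pd 0 (f 0 1)) z
      = pd 0 (pd 0 (f 0 0)) z * pd 2 F z + pd 0 (f 0 0) z * pd 0 (pd 2 F) z := by
  rw [pd_comm S.isOpen (S.smooth 0 1) hz]
  have h := deriv_eq_of_line (k := 0) S.isOpen hz (S.line_pd 0 1 1 0 hz)
    ((S.line_pd 0 0 0 0 hz).fun_mul (S.line_pd2F 0 hz)) (fun s hs => S.pd1_f12 hs)
  simpa using h

lemma pd1_pd0_f32 (S : StructureIdentities η U f F) (hz : z ∈ U) :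
    pd 1 (pd 0 (f 2 1)) z
      = pd 0 (pd 0 (f 2 0)) z * pd 2 F z + pd 0 (f 2 0) z * pd 0 (pd 2 F) z := by
  rw [pd_comm S.isOpen (S.smooth 2 1) hz]
  have h := deriv_eq_of_line (k := 0) S.isOpen hz (S.line_pd 2 1 1 0 hz)
    ((S.line_pd 2 0 0 0 hz).fun_mul (S.line_pd2F 0 hz)) (fun s hs => S.pd1_f32 hs)
  simpa using h

/-- Elimination of `F` from the first and the third structure equation. -/
lemma compat (S : StructureIdentities η U f F) (hz : z ∈ U) :
    pd 0 (f 2 0) z * (pd 0 (f 0 1) z * z 1 - (f 2 0 z * f 1 1 z - f 2 1 z * η))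
      = pd 0 (f 0 0) z * (pd 0 (f 2 1) z * z 1 - (f 0 0 z * f 1 1 z - f 0 1 z * η)) := by
  have h1 := S.eq₁ z hz
  have h3 := S.eq₃ z hz
  rw [S.pd1_f12 hz] at h1
  rw [S.pd1_f32 hz] at h3
  linear_combination pd 0 (f 2 0) z * h1 - pd 0 (f 0 0) z * h3

lemma compat_pd1 (S : StructureIdentities η U f F) (hz : z ∈ U) :
    pd 0 (f 2 0) z * pd 0 (f 0 1) z - pd 0 (f 0 0) z * pd 0 (f 2 1) z
      - z 1 * pd 2 F z * (pd 0 (f 0 0) z * pd 0 (pd 0 (f 2 0)) z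
          - pd 0 (f 2 0) z * pd 0 (pd 0 (f 0 0)) z)
      + η * pd 2 F z * (pd 0 (f 2 0) z ^ 2 - pd 0 (f 0 0) z ^ 2) = 0 := by
  have h := deriv_eq_of_line (k := 1) S.isOpen hz
    ((S.line_pd 2 0 0 1 hz).fun_mul
      (((S.line_pd 0 1 0 1 hz).fun_mul (hasDerivAt_line_apply 1 z 1)).fun_sub
        (((S.line_f 2 0 1 hz).fun_mul (S.line_f 1 1 1 hz)).fun_sub
          ((S.line_f 2 1 1 hz).mul_const η))))
    ((S.line_pd 0 0 0 1 hz).fun_mul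
      (((S.line_pd 2 1 0 1 hz).fun_mul (hasDerivAt_line_apply 1 z 1)).fun_sub
        (((S.line_f 0 0 1 hz).fun_mul (S.line_f 1 1 1 hz)).fun_sub
          ((S.line_f 0 1 1 hz).mul_const η)))) (fun s hs => S.compat hs)
  simp only [line_zero, S.pd1_pd_dx _ _ hz, S.pd1_dx _ _ hz, S.pd1_f22 hz, S.pd1_f32 hz,
    S.pd1_f12 hz, S.pd1_pd0_f12 hz, S.pd1_pd0_f32 hz, if_true] at h
  linear_combination h

/-- The Wronskian of the derivatives of `f₁₁` and `f₃₁` vanishes. -/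
lemma wronskian_eq_zero (S : StructureIdentities η U f F) (hz : z ∈ U) :
    pd 0 (f 0 0) z * pd 0 (pd 0 (f 2 0)) z - pd 0 (f 2 0) z * pd 0 (pd 0 (f 0 0)) z = 0 := by
  set Wr : (Fin 3 → ℝ) → ℝ := fun z =>
    pd 0 (f 0 0) z * pd 0 (pd 0 (f 2 0)) z - pd 0 (f 2 0) z * pd 0 (pd 0 (f 0 0)) z with hWr
  change Wr z = 0
  have smooth₁ (i : Fin 3) : ContDiffOn ℝ ∞ (pd 0 (f i 0)) U :=
    contDiffOn_pd S.isOpen (S.smooth _ _) 0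
  have smooth₂ (i : Fin 3) : ContDiffOn ℝ ∞ (pd 0 (pd 0 (f i 0))) U :=
    contDiffOn_pd S.isOpen (smooth₁ i) 0
  have hWc : ContDiffOn ℝ ∞ Wr U :=
    ((smooth₁ 0).mul (smooth₂ 2)).sub ((smooth₁ 2).mul (smooth₂ 0))
  have hW1 {w} (hw : w ∈ U) : pd 1 Wr w = 0 := by
    have line₂ (i : Fin 3) := hasDerivAt_line S.isOpen (smooth₂ i) hw 1
    have h := deriv_eq_of_line (k := 1) S.isOpen hw (hasDerivAt_line S.isOpen hWc hw 1)
      (((S.line_pd 0 0 0 1 hw).fun_mul (line₂ 2)).fun_sub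
        ((S.line_pd 2 0 0 1 hw).fun_mul (line₂ 0))) (fun s _ => rfl)
    have hpp (i : Fin 3) : pd 1 (pd 0 (pd 0 (f i 0))) w = 0 :=
      pd_pd_eq_zero S.isOpen (smooth₁ i) (fun _ h => S.pd1_pd_dx i 0 h) hw 0
    simpa [hpp, S.pd1_pd_dx _ _ hw] using h
  by_contra hne
  set V := U ∩ {w | Wr w ≠ 0}
  have hVo : IsOpen V := hWc.continuousOn.isOpen_inter_preimage S.isOpen isOpen_ne
  have hzV : z ∈ V := ⟨hz, hne⟩
  -- Where L ≠ 0, G does not depend on z₁, so `compat_pd1` can be differentiated once more. If L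
  -- vanishes on all of V, its z₀-derivative is used instead.
  by_cases hL : ∃ w ∈ V, f 0 0 w * pd 0 (f 2 0) w - f 2 0 w * pd 0 (f 0 0) w ≠ 0
  · obtain ⟨w, hw, hLw⟩ := hL
    have hG : pd 1 (pd 2 F) w = 0 := by
      simpa [hLw] using S.pd1_pd2F_mul hw.1
    have hwU := hw.1
    have h := deriv_eq_of_line (k := 1) S.isOpen hwU
      (((((S.line_pd 2 0 0 1 hwU).fun_mul (S.line_pd 0 1 0 1 hwU)).fun_sub
        ((S.line_pd 0 0 0 1 hwU).fun_mul (S.line_pd 2 1 0 1 hwU))).fun_sub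
        (((hasDerivAt_line_apply 1 w 1).fun_mul (S.line_pd2F 1 hwU)).fun_mul
          (hasDerivAt_line S.isOpen hWc hwU 1))).fun_add
        (((S.line_pd2F 1 hwU).const_mul η).fun_mul
          (((S.line_pd 2 0 0 1 hwU).fun_pow 2).fun_sub ((S.line_pd 0 0 0 1 hwU).fun_pow 2))))
      (hasDerivAt_const (0 : ℝ) (0 : ℝ)) (fun s hs => S.compat_pd1 hs)
    simp only [line_zero, S.pd1_pd_dx _ _ hwU, hG, hW1 hwU, S.pd1_pd0_f12 hwU,
      S.pd1_pd0_f32 hwU, if_true] at h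
    -- The first two terms of `compat_pd1` and the term z₁·G·Wr each contribute −G·Wr, whence the
    -- factor 2.
    have h2 : pd 2 F w * Wr w = 0 := by
      rw [hWr] at h ⊢
      linear_combination -h / 2
    exact (mul_ne_zero (S.pd_F_ne w hwU) hw.2) h2
  · push Not at hL
    -- L = 0 and its z₀-derivative f₁₁f₃₁'' − f₃₁f₁₁'' = 0 form a linear system for (f₁₁, f₃₁) with
    -- determinant Wr ≠ 0 up to sign. So both functions vanish on V, which `nondeg` forbids.
    have key {w} (hw : w ∈ V) : f 0 0 w = 0 ∧ f 2 0 w = 0 := by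
      have hwU := hw.1
      have h := deriv_eq_of_line (k := 0) hVo hw
        (((S.line_f 0 0 0 hwU).fun_mul (S.line_pd 2 0 0 0 hwU)).fun_sub
          ((S.line_f 2 0 0 hwU).fun_mul (S.line_pd 0 0 0 0 hwU)))
        (hasDerivAt_const (0 : ℝ) (0 : ℝ)) (fun s hs => hL _ hs)
      simp only [line_zero] at h
      have hLw := hL w hw
      have hne : Wr w ≠ 0 := hw.2
      constructor
      · refine (mul_eq_zero.1 (?_ : Wr w * f 0 0 w = 0)).resolve_left hne
        rw [hWr]
        linear_combination pd 0 (f 0 0) w * h - pd 0 (pd 0 (f 0 0)) w * hLw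
      · refine (mul_eq_zero.1 (?_ : Wr w * f 2 0 w = 0)).resolve_left hne
        rw [hWr]
        linear_combination pd 0 (f 2 0) w * h - pd 0 (pd 0 (f 2 0)) w * hLw
    rcases S.nondeg z hz with h | h
    · exact h (pd_eq_zero_of_eqOn_const hVo (fun w hw => (key hw).1) hzV 0)
    · exact h (pd_eq_zero_of_eqOn_const hVo (fun w hw => (key hw).2) hzV 0)

lemma exists_area_ne_zero (S : StructureIdentities η U f F) {V : Set (Fin 3 → ℝ)} (hV : IsOpen V)
    (hVU : V ⊆ U) (hz : z ∈ V) : ∃ w ∈ V, area f w ≠ 0 := by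
  obtain ⟨w, hw, hw'⟩ := mem_closure_iff.1 (S.dense (hVU hz)) V hV hz
  exact ⟨w, hw, hw'.2⟩

end StructureIdentities

end

/-! ### Total derivatives on jet spaces and their dependence on the highest variable. -/

section

section Jets

variable {m : ℕ} {x t : ℝ} {Z : ℕ → ℝ}

/-- The point of the jet space determined by `(x, t)` and an infinite spatial jet. -/
def jetPoint (m : ℕ) (x t : ℝ) (Z : ℕ → ℝ) : JetSpace m := (x, t, res (3 + m) Z)

/-- The vector `∂/∂z_j` on the jet space; it is `0` if `j` exceeds the order of the jets. -/
def vert (m j : ℕ) : JetSpace m := (0, 0, res (3 + m) (Pi.single j 1))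

/-- The projection of the jet space onto the space of `2`-jets, as a continuous linear map. -/
def baseL (m : ℕ) : JetSpace m →L[ℝ] (Fin 3 → ℝ) :=
  ContinuousLinearMap.pi fun k => (ContinuousLinearMap.proj (Fin.castAdd m k)).comp
    ((ContinuousLinearMap.snd ℝ ℝ (Fin (3 + m) → ℝ)).comp
      (ContinuousLinearMap.snd ℝ ℝ (ℝ × (Fin (3 + m) → ℝ))))

lemma baseL_apply (q : JetSpace m) : baseL m q = base q := rfl

lemma continuous_base : Continuous (base : JetSpace m → Fin 3 → ℝ) := (baseL m).continuous

/-- Open subsets of W project to open subsets of U, where the density of ω¹ ∧ ω² ≠ 0 can be applied.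
-/
lemma isOpenMap_base : IsOpenMap (base : JetSpace m → Fin 3 → ℝ) := by
  refine (baseL m).isOpenMap fun v => ?_
  refine ⟨(0, 0, fun i => if h : (i : ℕ) < 3 then v ⟨i, h⟩ else 0), ?_⟩
  rw [baseL_apply]
  ext k
  simp [base]

lemma base_jetPoint : base (jetPoint m x t Z) = res 3 Z := rfl

lemma exists_jetPoint_eq (q : JetSpace m) : ∃ Z, q = jetPoint m q.1 q.2.1 Z := by
  refine ⟨fun i => if h : i < 3 + m then q.2.2 ⟨i, h⟩ else 0, ?_⟩
  simp only [jetPoint]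
  refine Prod.ext rfl (Prod.ext rfl ?_)
  ext k
  simp [res]

lemma res_line (n j : ℕ) (Z : ℕ → ℝ) (s : ℝ) :
    res n (line j Z s) = res n Z + s • res n (Pi.single j 1) := rfl

lemma res_single_of_le {n j : ℕ} (h : n ≤ j) : res n (Pi.single j 1) = 0 := by
  ext k
  have : (k : ℕ) ≠ j := by omega
  simp [res, this]

lemma res_single_of_lt {n : ℕ} (k : Fin n) : res n (Pi.single (k : ℕ) 1) = Pi.single k 1 := by
  ext i
  simp [res, Pi.single_apply, Fin.ext_iff]

lemma res_line_of_le {n j : ℕ} (h : n ≤ j) (s : ℝ) : res n (line j Z s) = res n Z := by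
  simp [res_line, res_single_of_le h]

lemma res_line_coe (k : Fin 3) (s : ℝ) : res 3 (line (k : ℕ) Z s) = line k (res 3 Z) s := by
  rw [res_line, res_single_of_lt, line]

lemma res_line_zero (s : ℝ) : res 3 (line 0 Z s) = line 0 (res 3 Z) s := res_line_coe 0 s
lemma res_line_one (s : ℝ) : res 3 (line 1 Z s) = line 1 (res 3 Z) s := res_line_coe 1 s
lemma res_line_two (s : ℝ) : res 3 (line 2 Z s) = line 2 (res 3 Z) s := res_line_coe 2 s

lemma jetPoint_line (j : ℕ) (s : ℝ) :
    jetPoint m x t (line j Z s) = jetPoint m x t Z + s • vert m j := by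
  simp [jetPoint, vert, res_line]

lemma vert_of_le {j : ℕ} (h : 3 + m ≤ j) : vert m j = 0 := by
  simp [vert, res_single_of_le h]

lemma eventually_jetPoint_line_mem {O : Set (JetSpace m)} (hO : IsOpen O)
    (hq : jetPoint m x t Z ∈ O) (j : ℕ) :
    ∀ᶠ s in 𝓝 (0 : ℝ), jetPoint m x t (line j Z s) ∈ O := by
  have hc : Continuous fun s => jetPoint m x t (line j Z s) := by
    simp only [jetPoint_line]; fun_prop
  exact hc.continuousAt.eventually_mem (by simpa using hO.mem_nhds hq)

lemma deriv_eq_of_jetLine {O : Set (JetSpace m)} (hO : IsOpen O) (hq : jetPoint m x t Z ∈ O)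
    (j : ℕ) {φ ψ : ℝ → ℝ} {d e : ℝ} (hφ : HasDerivAt φ d 0) (hψ : HasDerivAt ψ e 0)
    (he : ∀ s, jetPoint m x t (line j Z s) ∈ O → φ s = ψ s) : d = e :=
  hφ.unique (hψ.congr_of_eventuallyEq ((eventually_jetPoint_line_mem hO hq j).mono he))

section Functions

variable {W : Set (JetSpace m)} {a : JetSpace m → ℝ}

lemma hasDerivAt_jetLine (hW : IsOpen W) (ha : ContDiffOn ℝ ∞ a W) (hq : jetPoint m x t Z ∈ W)
    (j : ℕ) : HasDerivAt (fun s => a (jetPoint m x t (line j Z s)))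
      (fderiv ℝ a (jetPoint m x t Z) (vert m j)) 0 := by
  simp only [jetPoint_line]
  exact hasDerivAt_comp_add_smul hW ha hq _

lemma hasDerivAt_jetLine_fderiv (hW : IsOpen W) (ha : ContDiffOn ℝ ∞ a W)
    (hq : jetPoint m x t Z ∈ W) {j : ℕ} (h0 : ∀ q ∈ W, fderiv ℝ a q (vert m j) = 0)
    (w : JetSpace m) :
    HasDerivAt (fun s => fderiv ℝ a (jetPoint m x t (line j Z s)) w) 0 0 := by
  have h := hasDerivAt_jetLine hW (contDiffOn_fderiv_apply hW ha w) hq j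
  rwa [fderiv_fderiv_eq_zero hW ha h0 hq] at h

lemma Dx_line (a : JetSpace m → ℝ) (x t : ℝ) (Z : ℕ → ℝ) (j : ℕ) (s : ℝ) :
    Dx a x t (line (j + 1) Z s)
      = fderiv ℝ a (jetPoint m x t (line (j + 1) Z s)) (1, 0, fun k => Z (k + 1))
        + s * fderiv ℝ a (jetPoint m x t (line (j + 1) Z s)) (vert m j) := by
  have h : ((1, 0, fun k : Fin (3 + m) => line (j + 1) Z s (k + 1)) : JetSpace m)
      = ((1, 0, fun k : Fin (3 + m) => Z (k + 1)) : JetSpace m) + s • vert m j := by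
    simp only [vert]
    refine Prod.ext (by simp) (Prod.ext (by simp) ?_)
    ext k
    simp [line, res, Pi.single_apply]
  rw [Dx, h, map_add, map_smul]
  rfl

/-- If `a` does not depend on `z_{j+1}`, then `∂(D_x a)/∂z_{j+1} = ∂a/∂z_j`. -/
lemma hasDerivAt_Dx (hW : IsOpen W) (ha : ContDiffOn ℝ ∞ a W) (hq : jetPoint m x t Z ∈ W) {j : ℕ}
    (h0 : ∀ q ∈ W, fderiv ℝ a q (vert m (j + 1)) = 0) :
    HasDerivAt (fun s => Dx a x t (line (j + 1) Z s))
      (fderiv ℝ a (jetPoint m x t Z) (vert m j)) 0 := by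
  simp only [Dx_line]
  have h := (hasDerivAt_jetLine_fderiv hW ha hq h0 (1, 0, fun k => Z (k + 1))).fun_add
    ((hasDerivAt_id (0 : ℝ)).fun_mul (hasDerivAt_jetLine_fderiv hW ha hq h0 (vert m j)))
  simpa using h

lemma jet_eq_sum (w : ℕ → ℝ) :
    ((0, 1, fun k : Fin (3 + m) => w k) : JetSpace m)
      = (0, 1, 0) + ∑ i ∈ Finset.range (3 + m), w i • vert m i := by
  rw [Finset.sum_range]
  have h2 : ∑ i : Fin (3 + m), w i • vert m i
      = ((0, 0, fun k : Fin (3 + m) => w k) : JetSpace m) := by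
    have h3 (i : Fin (3 + m)) : w i • vert m i = (0, 0, w i • Pi.single i 1) := by
      simp only [vert, res_single_of_lt]
      simp
    simp only [h3]
    refine Prod.ext (by simp [Prod.fst_sum]) (Prod.ext (by simp [Prod.fst_sum, Prod.snd_sum]) ?_)
    ext k
    simp [Prod.snd_sum, Finset.sum_apply, Pi.single_apply]
  rw [h2]
  simp

lemma Dt_eq_sum (F : (Fin 3 → ℝ) → ℝ) (a : JetSpace m → ℝ) (x t : ℝ) (Z : ℕ → ℝ) :
    Dt F a x t Z = fderiv ℝ a (jetPoint m x t Z) (0, 1, 0)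
      + ∑ i ∈ Finset.range (3 + m),
          timeDer F i (res (3 + i) Z) * fderiv ℝ a (jetPoint m x t Z) (vert m i) := by
  rw [Dt, jet_eq_sum (fun k => timeDer F k (res (3 + k) Z)), map_add, map_sum]
  simp only [map_smul, smul_eq_mul]
  rfl

end Functions

section TimeDer

variable {U : Set (Fin 3 → ℝ)} {F : (Fin 3 → ℝ) → ℝ}

lemma isOpen_truncation (hU : IsOpen U) (i : ℕ) :
    IsOpen {z : Fin (3 + i) → ℝ | (fun k : Fin 3 => z (Fin.castAdd i k)) ∈ U} :=
  hU.preimage (by fun_prop)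

lemma contDiffOn_timeDer (hU : IsOpen U) (hF : ContDiffOn ℝ ∞ F U) (i : ℕ) :
    ContDiffOn ℝ ∞ (timeDer F i)
      {z : Fin (3 + i) → ℝ | (fun k : Fin 3 => z (Fin.castAdd i k)) ∈ U} := by
  induction i with
  | zero => exact hF
  | succ i ih =>
    have h1 := ih.fderiv_of_isOpen (isOpen_truncation hU i) (m := ∞) (by simp)
    have h2 : ContDiff ℝ ∞
        (fun z : Fin (3 + i + 1) → ℝ => fun k : Fin (3 + i) => z k.castSucc) := by
      fun_prop
    have h3 : ContDiff ℝ ∞ (fun z : Fin (3 + i + 1) → ℝ => fun k : Fin (3 + i) => z k.succ) := by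
      fun_prop
    exact (h1.comp h2.contDiffOn (fun z hz => hz)).clm_apply h3.contDiffOn

/-- The variable z_{i+3} enters D_x^{i+1}F only through the last component of the direction vector
in `totalX`, so the dependence on it is affine. -/
lemma timeDer_line_succ (i : ℕ) (s : ℝ) :
    timeDer F (i + 1) (res (3 + (i + 1)) (line (i + 3) Z s))
      = fderiv ℝ (timeDer F i) (res (3 + i) Z) (fun k => Z (k + 1))
        + s * fderiv ℝ (timeDer F i) (res (3 + i) Z) (res (3 + i) (Pi.single (i + 2) 1)) := by
  have h1 : (fun k : Fin (3 + i) => res (3 + (i + 1)) (line (i + 3) Z s) k.castSucc)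
      = res (3 + i) Z := res_line_of_le (by omega) s
  have h2 : (fun k : Fin (3 + i) => res (3 + (i + 1)) (line (i + 3) Z s) k.succ)
      = (fun k : Fin (3 + i) => Z (k + 1)) + s • res (3 + i) (Pi.single (i + 2) 1) := by
    ext k
    simp [line, res, Pi.single_apply]
  change totalX (timeDer F i) _ = _
  rw [totalX, h1, h2, map_add, map_smul]
  rfl

/-- Each D_x raises the order by one and passes on the coefficient of the highest variable, so
D_x^iF always has leading coefficient G. -/
lemma fderiv_timeDer_last (hU : IsOpen U) (hF : ContDiffOn ℝ ∞ F U) (hZ : res 3 Z ∈ U) (i : ℕ) :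
    fderiv ℝ (timeDer F i) (res (3 + i) Z) (res (3 + i) (Pi.single (i + 2) 1))
      = pd 2 F (res 3 Z) := by
  induction i with
  | zero =>
    have : res 3 (Pi.single 2 1) = Pi.single 2 1 := res_single_of_lt 2
    change fderiv ℝ F (res 3 Z) (res 3 (Pi.single 2 1)) = _
    rw [this, pd]
  | succ i ih =>
    have h1 := hasDerivAt_comp_add_smul (isOpen_truncation hU (i + 1))
      (contDiffOn_timeDer hU hF (i + 1)) (q := res (3 + (i + 1)) Z) hZ
      (res (3 + (i + 1)) (Pi.single (i + 3) 1))
    have h2 := ((hasDerivAt_id (0 : ℝ)).mul_const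
      (fderiv ℝ (timeDer F i) (res (3 + i) Z) (res (3 + i) (Pi.single (i + 2) 1)))).const_add
      (fderiv ℝ (timeDer F i) (res (3 + i) Z) (fun k => Z (k + 1)))
    rw [ih] at h2
    have h3 := h1.unique (h2.congr_of_eventuallyEq (Eventually.of_forall fun s => by
      have := timeDer_line_succ (F := F) (Z := Z) i s
      rw [ih] at this
      exact this))
    simpa using h3

lemma hasDerivAt_timeDer_last (hU : IsOpen U) (hF : ContDiffOn ℝ ∞ F U) (hZ : res 3 Z ∈ U)
    (i : ℕ) : HasDerivAt (fun s => timeDer F i (res (3 + i) (line (i + 2) Z s)))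
      (pd 2 F (res 3 Z)) 0 := by
  have h := hasDerivAt_comp_add_smul (isOpen_truncation hU i)
      (contDiffOn_timeDer hU hF i) (q := res (3 + i) Z) hZ
      (res (3 + i) (Pi.single (i + 2) 1))
  rwa [fderiv_timeDer_last hU hF hZ] at h

/-- If `a` does not depend on `z_j` for `j > k`, then `∂(D_t a)/∂z_{k+2} = F_{z₂} ∂a/∂z_k`. -/
lemma hasDerivAt_Dt (hU : IsOpen U) (hF : ContDiffOn ℝ ∞ F U) (hZ : res 3 Z ∈ U)
    {W : Set (JetSpace m)} {a : JetSpace m → ℝ} (hW : IsOpen W) (ha : ContDiffOn ℝ ∞ a W)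
    (hq : jetPoint m x t Z ∈ W) {k : ℕ}
    (h0 : ∀ j, k < j → ∀ q ∈ W, fderiv ℝ a q (vert m j) = 0) :
    HasDerivAt (fun s => Dt F a x t (line (k + 2) Z s))
      (pd 2 F (res 3 Z) * fderiv ℝ a (jetPoint m x t Z) (vert m k)) 0 := by
  simp only [Dt_eq_sum]
  have hk := h0 (k + 2) (by omega)
  have hterm (i : ℕ) : HasDerivAt (fun s => timeDer F i (res (3 + i) (line (k + 2) Z s))
      * fderiv ℝ a (jetPoint m x t (line (k + 2) Z s)) (vert m i))
      (if i = k then pd 2 F (res 3 Z) * fderiv ℝ a (jetPoint m x t Z) (vert m k) else 0) 0 := by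
    -- For i < k the factor D_x^iF does not contain z_{k+2}; for i = k it is affine in z_{k+2} with
    -- slope G; for i > k the derivative of a vanishes.
    rcases lt_trichotomy i k with h | h | h
    · simp only [h.ne, if_false, res_line_of_le (show 3 + i ≤ k + 2 by omega)]
      simpa using (hasDerivAt_jetLine_fderiv hW ha hq hk (vert m i)).const_mul
        (timeDer F i (res (3 + i) Z))
    · subst h
      simpa using (hasDerivAt_timeDer_last hU hF hZ i).fun_mul
        (hasDerivAt_jetLine_fderiv hW ha hq hk (vert m i))
    · simp only [h.ne', if_false]
      refine (hasDerivAt_const (0 : ℝ) (0 : ℝ)).congr_of_eventuallyEq ?_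
      filter_upwards [eventually_jetPoint_line_mem hW hq (k + 2)] with s hs
      rw [h0 i h _ hs, mul_zero]
  have h := (hasDerivAt_jetLine_fderiv hW ha hq hk (0, 1, 0)).fun_add
    (HasDerivAt.fun_sum (u := Finset.range (3 + m)) fun i _ => hterm i)
  rw [Finset.sum_ite_eq', zero_add] at h
  -- When k exceeds the order of the jets, the sum has no k-th term, in agreement with `vert m k =
  -- 0`.
  by_cases hkm : k < 3 + m
  · simpa [hkm] using h
  · simpa [hkm, vert_of_le (not_lt.1 hkm)] using h

end TimeDer

end Jets

end

/-! ### The Codazzi equations on jet space, and the case where ∂_x is an asymptotic direction. -/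

section

section Product

variable {m : ℕ} {q : JetSpace m} {a b : JetSpace m → ℝ} {g h : (Fin 3 → ℝ) → ℝ}

lemma fderiv_combination (ha : DifferentiableAt ℝ a q) (hb : DifferentiableAt ℝ b q)
    (hg : DifferentiableAt ℝ g (base q)) (hh : DifferentiableAt ℝ h (base q)) (v : JetSpace m) :
    fderiv ℝ (fun p => a p * g (base p) + b p * h (base p)) q v
      = fderiv ℝ a q v * g (base q) + a q * fderiv ℝ g (base q) (base v)
        + (fderiv ℝ b q v * h (base q) + b q * fderiv ℝ h (base q) (base v)) := by
  have hB : HasFDerivAt (base : JetSpace m → Fin 3 → ℝ) (baseL m) q := (baseL m).hasFDerivAt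
  have h1 := ((ha.hasFDerivAt.fun_mul (hg.hasFDerivAt.comp q hB)).fun_add
    (hb.hasFDerivAt.fun_mul (hh.hasFDerivAt.comp q hB))).fderiv
  have h2 := congrArg (fun L : JetSpace m →L[ℝ] ℝ => L v) h1
  simp only [Function.comp_apply] at h2
  refine h2.trans ?_
  simp [baseL_apply]
  ring

end Product

/-- The coefficient of `dx ∧ dt` in `ω² ∧ ω¹`, when `f₂₁ = η`. -/
def coarea (η : ℝ) (f : Coeffs) (z : Fin 3 → ℝ) : ℝ := η * f 0 1 z - f 0 0 z * f 1 1 z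

/-- The total `x`-derivative of `coarea`. -/
def coareaX (η : ℝ) (f : Coeffs) (Z : ℕ → ℝ) : ℝ :=
  η * (pd 0 (f 0 1) (res 3 Z) * Z 1 + pd 1 (f 0 1) (res 3 Z) * Z 2)
    - pd 0 (f 0 0) (res 3 Z) * Z 1 * f 1 1 (res 3 Z)
    - f 0 0 (res 3 Z) * (pd 0 (f 1 1) (res 3 Z) * Z 1)

variable {η : ℝ} {U : Set (Fin 3 → ℝ)} {f : Coeffs} {F : (Fin 3 → ℝ) → ℝ}
  {m : ℕ} {W : Set (JetSpace m)} {a b c : JetSpace m → ℝ} {x t : ℝ} {Z : ℕ → ℝ}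

/-- Serves both Codazzi equations, with (a, b) and with (b, c). The derivatives of the f_{ij} are
eliminated by dω¹ = ω³ ∧ ω² and dω² = ω¹ ∧ ω³. -/
lemma totalD_combination (S : StructureIdentities η U f F)
    (hz : res 3 Z ∈ U) (ha : DifferentiableAt ℝ a (jetPoint m x t Z))
    (hb : DifferentiableAt ℝ b (jetPoint m x t Z)) :
    totalD F (fun p => a p * f 0 0 (base p) + b p * f 1 0 (base p))
        (fun p => a p * f 0 1 (base p) + b p * f 1 1 (base p)) x t Z
      = f 0 1 (res 3 Z) * Dx a x t Z - f 0 0 (res 3 Z) * Dt F a x t Z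
        + f 1 1 (res 3 Z) * Dx b x t Z - η * Dt F b x t Z
        + a (jetPoint m x t Z) * (f 2 0 (res 3 Z) * f 1 1 (res 3 Z) - f 2 1 (res 3 Z) * η)
        + b (jetPoint m x t Z)
          * (f 0 0 (res 3 Z) * f 2 1 (res 3 Z) - f 0 1 (res 3 Z) * f 2 0 (res 3 Z)) := by
  have e0 (i j) : DifferentiableAt ℝ (f i j) (base (jetPoint m x t Z)) :=
    differentiableAt_of_smooth S.isOpen (S.smooth i j) hz
  rw [totalD, Dx, Dt]
  change fderiv ℝ _ (jetPoint m x t Z) _ - fderiv ℝ _ (jetPoint m x t Z) _ = _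
  rw [fderiv_combination ha hb (e0 _ _) (e0 _ _), fderiv_combination ha hb (e0 _ _) (e0 _ _)]
  simp only [fderiv_apply_eq_sum, base_jetPoint, S.pd1_dx _ _ hz, S.pd2_dx _ _ hz,
    S.pd2_dt _ _ hz, S.f21 _ hz, pd_eq_zero_of_eqOn_const S.isOpen S.f21 hz]
  change Dx a x t Z * f 0 1 (res 3 Z) + a (jetPoint m x t Z) *
      (Z 1 * pd 0 (f 0 1) (res 3 Z) + Z 2 * pd 1 (f 0 1) (res 3 Z) + Z 3 * 0)
      + (Dx b x t Z * f 1 1 (res 3 Z) + b (jetPoint m x t Z) *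
        (Z 1 * pd 0 (f 1 1) (res 3 Z) + Z 2 * pd 1 (f 1 1) (res 3 Z) + Z 3 * 0))
      - (Dt F a x t Z * f 0 0 (res 3 Z) + a (jetPoint m x t Z) *
          (F (res 3 Z) * pd 0 (f 0 0) (res 3 Z) + _ * 0 + _ * 0)
        + (Dt F b x t Z * η + b (jetPoint m x t Z) * (_ * 0 + _ * 0 + _ * 0))) = _
  have h1 := S.eq₁ _ hz
  have h2 := S.eq₂ _ hz
  have r1 : res 3 Z 1 = Z 1 := rfl
  have r2 : res 3 Z 2 = Z 2 := rfl
  rw [r1, r2] at h1 h2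
  linear_combination a (jetPoint m x t Z) * h1 + b (jetPoint m x t Z) * h2

namespace IsSecondFundamentalForm

lemma diff_f (S : StructureIdentities η U f F) (H : IsSecondFundamentalForm U f F W a b c)
    {q : JetSpace m} (hq : q ∈ W) (i : Fin 3) (j : Fin 2) : DifferentiableAt ℝ (f i j) (base q) :=
  differentiableAt_of_smooth S.isOpen (S.smooth i j) (H.base_mem q hq)

lemma base_mem_jetPoint (H : IsSecondFundamentalForm U f F W a b c)
    (hq : jetPoint m x t Z ∈ W) : res 3 Z ∈ U := H.base_mem _ hq

lemma codazzi₁_expanded (S : StructureIdentities η U f F)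
    (H : IsSecondFundamentalForm U f F W a b c) (hq : jetPoint m x t Z ∈ W) :
    f 0 1 (res 3 Z) * Dx a x t Z - f 0 0 (res 3 Z) * Dt F a x t Z
      + f 1 1 (res 3 Z) * Dx b x t Z - η * Dt F b x t Z
      + 2 * b (jetPoint m x t Z)
        * (f 0 0 (res 3 Z) * f 2 1 (res 3 Z) - f 0 1 (res 3 Z) * f 2 0 (res 3 Z))
      + (a (jetPoint m x t Z) - c (jetPoint m x t Z))
        * (f 2 0 (res 3 Z) * f 1 1 (res 3 Z) - f 2 1 (res 3 Z) * η) = 0 := by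
  have hz : res 3 Z ∈ U := H.base_mem_jetPoint hq
  have h := H.codazzi₁ x t Z hq
  rw [totalD_combination S hz (differentiableAt_of_smooth H.isOpen H.smooth_a hq)
    (differentiableAt_of_smooth H.isOpen H.smooth_b hq)] at h
  have hbase : base ((x, t, res (3 + m) Z) : JetSpace m) = res 3 Z := rfl
  simp only [wedge, hbase, S.f21 _ hz] at h
  rw [jetPoint] at h ⊢
  linear_combination h

lemma codazzi₂_expanded (S : StructureIdentities η U f F)
    (H : IsSecondFundamentalForm U f F W a b c) (hq : jetPoint m x t Z ∈ W) :
    f 0 1 (res 3 Z) * Dx b x t Z - f 0 0 (res 3 Z) * Dt F b x t Z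
      + f 1 1 (res 3 Z) * Dx c x t Z - η * Dt F c x t Z
      + 2 * b (jetPoint m x t Z)
        * (f 2 0 (res 3 Z) * f 1 1 (res 3 Z) - f 2 1 (res 3 Z) * η)
      + (c (jetPoint m x t Z) - a (jetPoint m x t Z))
        * (f 0 0 (res 3 Z) * f 2 1 (res 3 Z) - f 0 1 (res 3 Z) * f 2 0 (res 3 Z)) = 0 := by
  have hz : res 3 Z ∈ U := H.base_mem_jetPoint hq
  have h := H.codazzi₂ x t Z hq
  rw [totalD_combination S hz (differentiableAt_of_smooth H.isOpen H.smooth_b hq)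
    (differentiableAt_of_smooth H.isOpen H.smooth_c hq)] at h
  have hbase : base ((x, t, res (3 + m) Z) : JetSpace m) = res 3 Z := rfl
  simp only [wedge, hbase, S.f21 _ hz] at h
  rw [jetPoint] at h ⊢
  linear_combination h

section Degenerate

variable {O : Set (JetSpace m)}

/-- Since ω¹, ω² take the values f₁₁, η on ∂_x, `hdeg` says that the form aω¹² + 2bω¹ω² + cω²²
vanishes on ∂_x. Multiplying `hdeg` by a and using ac − b² = −1 completes the square. -/
lemma sq_eq_of_degenerate (S : StructureIdentities η U f F)
    (H : IsSecondFundamentalForm U f F W a b c) (hOW : O ⊆ W)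
    (hdeg : ∀ q ∈ O, c q * η ^ 2 + 2 * b q * η * f 0 0 (base q) + f 0 0 (base q) ^ 2 * a q = 0)
    {q : JetSpace m} (hq : q ∈ O) :
    (a q * f 0 0 (base q) + b q * f 1 0 (base q)) ^ 2 = η ^ 2 := by
  have h1 := hdeg q hq
  have h2 := H.gauss q (hOW hq)
  rw [S.f21 _ (H.base_mem q (hOW hq))]
  linear_combination a q * h1 - η ^ 2 * h2

/-- With φ = af₁₁ + bη and ψ = bf₁₁ + cη, φ² = η² ≠ 0 gives dφ = 0, and `hdeg` reads ηψ + φf₁₁ = 0.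
Differentiating expresses db and dc through da and df₁₁. -/
lemma fderiv_of_degenerate (S : StructureIdentities η U f F) (hη : η ≠ 0)
    (H : IsSecondFundamentalForm U f F W a b c) (hO : IsOpen O) (hOW : O ⊆ W)
    (hdeg : ∀ q ∈ O, c q * η ^ 2 + 2 * b q * η * f 0 0 (base q) + f 0 0 (base q) ^ 2 * a q = 0)
    {q : JetSpace m} (hq : q ∈ O) (v : JetSpace m) :
    fderiv ℝ a q v * f 0 0 (base q) + a q * (base v 0 * pd 0 (f 0 0) (base q))
        + fderiv ℝ b q v * η = 0 ∧
    (fderiv ℝ b q v * f 0 0 (base q) + b q * (base v 0 * pd 0 (f 0 0) (base q))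
        + fderiv ℝ c q v * η) * η
      + (a q * f 0 0 (base q) + b q * η) * (base v 0 * pd 0 (f 0 0) (base q)) = 0 := by
  have hqW := hOW hq
  have hz := H.base_mem q hqW
  have da := differentiableAt_of_smooth H.isOpen H.smooth_a hqW
  have db := differentiableAt_of_smooth H.isOpen H.smooth_b hqW
  have dc := differentiableAt_of_smooth H.isOpen H.smooth_c hqW
  have e0 (i j) : DifferentiableAt ℝ (f i j) (base q) := H.diff_f S hqW i j
  have hB : HasFDerivAt (base : JetSpace m → Fin 3 → ℝ) (baseL m) q := (baseL m).hasFDerivAt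
  have dB (i j) : DifferentiableAt ℝ (fun p : JetSpace m => f i j (base p)) q :=
    ((e0 i j).hasFDerivAt.comp q hB).differentiableAt
  have hsq := fun p (hp : p ∈ O) => H.sq_eq_of_degenerate S hOW hdeg hp
  have d10 : ∀ k, pd k (f 1 0) (base q) = 0 := pd_eq_zero_of_eqOn_const S.isOpen S.f21 hz
  have hf21 := S.f21 _ hz
  set φ : JetSpace m → ℝ := fun p => a p * f 0 0 (base p) + b p * f 1 0 (base p) with hφ
  set ψ : JetSpace m → ℝ := fun p => b p * f 0 0 (base p) + c p * f 1 0 (base p) with hψ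
  have dφ : DifferentiableAt ℝ φ q := (da.mul (dB 0 0)).add (db.mul (dB 1 0))
  have dψ : DifferentiableAt ℝ ψ q := (db.mul (dB 0 0)).add (dc.mul (dB 1 0))
  have φv : fderiv ℝ φ q v = 0 := by
    have h1 := fderiv_eq_zero_of_eqOn_const hO (g := fun p => φ p * φ p)
      (fun p hp => (sq (φ p)).symm.trans (hsq p hp)) hq
    rw [(dφ.hasFDerivAt.fun_mul dφ.hasFDerivAt).fderiv] at h1
    have h3 := congrArg (fun L : JetSpace m →L[ℝ] ℝ => L v) h1
    have hne : φ q ≠ 0 := fun h0 => by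
      have := hsq q hq
      change φ q ^ 2 = η ^ 2 at this
      rw [h0] at this
      exact pow_ne_zero 2 hη (by rw [← this]; ring)
    simp only [add_apply, smul_apply, smul_eq_mul, zero_apply] at h3
    exact mul_left_cancel₀ hne (by linarith)
  have hrel : ∀ p ∈ O, ψ p * f 1 0 (base p) + φ p * f 0 0 (base p) = 0 := by
    intro p hp
    have h1 := hdeg p hp
    simp only [hφ, hψ]
    rw [S.f21 _ (H.base_mem p (hOW hp))]
    linear_combination h1
  have ψv := congrArg (fun L : JetSpace m →L[ℝ] ℝ => L v) (fderiv_eq_zero_of_eqOn_const hO hrel hq)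
  simp only [fderiv_combination dψ dφ (e0 1 0) (e0 0 0), φv] at ψv
  simp only [hψ, fderiv_combination db dc (e0 0 0) (e0 1 0), fderiv_apply_eq_sum, d10,
    S.pd1_dx _ _ hz, S.pd2_dx _ _ hz, hf21, hφ] at ψv
  simp only [hφ, fderiv_combination da db (e0 0 0) (e0 1 0), fderiv_apply_eq_sum, d10,
    S.pd1_dx _ _ hz, S.pd2_dx _ _ hz, hf21] at φv
  simp only [zero_apply] at ψv
  exact ⟨by linear_combination φv, by linear_combination ψv⟩

/-- Removing the derivatives of b and c by `fderiv_of_degenerate` also removes D_t a from the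
Codazzi equations. The first becomes an equation for D_x a; with its help the second loses all
derivatives of a, b, c. -/
lemma coareaX_of_degenerate (S : StructureIdentities η U f F) (hη : η ≠ 0)
    (H : IsSecondFundamentalForm U f F W a b c) (hO : IsOpen O) (hOW : O ⊆ W)
    (hdeg : ∀ q ∈ O, c q * η ^ 2 + 2 * b q * η * f 0 0 (base q) + f 0 0 (base q) ^ 2 * a q = 0)
    (hq : jetPoint m x t Z ∈ O) :
    η * (coarea η f (res 3 Z) * Dx a x t Z + a (jetPoint m x t Z) * coareaX η f Z)
      = (2 * b (jetPoint m x t Z) * η + a (jetPoint m x t Z) * f 0 0 (res 3 Z))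
        * f 2 0 (res 3 Z) * coarea η f (res 3 Z) ∧
    2 * (a (jetPoint m x t Z) * f 0 0 (res 3 Z) + b (jetPoint m x t Z) * η) * η * coareaX η f Z
      = a (jetPoint m x t Z) * coarea η f (res 3 Z)
          * (η * (pd 0 (f 0 0) (res 3 Z) * Z 1)
            - (η ^ 2 + f 0 0 (res 3 Z) ^ 2) * f 2 0 (res 3 Z))
        + 2 * (a (jetPoint m x t Z) * f 0 0 (res 3 Z) + b (jetPoint m x t Z) * η)
          * f 0 0 (res 3 Z) * f 2 0 (res 3 Z) * coarea η f (res 3 Z) := by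
  have hz : res 3 Z ∈ U := H.base_mem_jetPoint (hOW hq)
  have E1 := H.codazzi₁_expanded S (hOW hq)
  have E2 := H.codazzi₂_expanded S (hOW hq)
  have h0 := hdeg _ hq
  have hx := H.fderiv_of_degenerate S hη hO hOW hdeg hq (1, 0, fun k => Z (k + 1))
  have ht := H.fderiv_of_degenerate S hη hO hOW hdeg hq
    (0, 1, fun k => timeDer F k (res (3 + k) Z))
  change
    Dx a x t Z * f 0 0 (res 3 Z) + a (jetPoint m x t Z) * (Z 1 * pd 0 (f 0 0) (res 3 Z))
        + Dx b x t Z * η = 0 ∧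
    (Dx b x t Z * f 0 0 (res 3 Z) + b (jetPoint m x t Z) * (Z 1 * pd 0 (f 0 0) (res 3 Z))
        + Dx c x t Z * η) * η
      + (a (jetPoint m x t Z) * f 0 0 (res 3 Z) + b (jetPoint m x t Z) * η)
        * (Z 1 * pd 0 (f 0 0) (res 3 Z)) = 0 at hx
  change
    Dt F a x t Z * f 0 0 (res 3 Z)
        + a (jetPoint m x t Z) * (F (res 3 Z) * pd 0 (f 0 0) (res 3 Z))
        + Dt F b x t Z * η = 0 ∧
    (Dt F b x t Z * f 0 0 (res 3 Z)
        + b (jetPoint m x t Z) * (F (res 3 Z) * pd 0 (f 0 0) (res 3 Z))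
        + Dt F c x t Z * η) * η
      + (a (jetPoint m x t Z) * f 0 0 (res 3 Z) + b (jetPoint m x t Z) * η)
        * (F (res 3 Z) * pd 0 (f 0 0) (res 3 Z)) = 0 at ht
  rw [base_jetPoint] at h0
  obtain ⟨x1, x2⟩ := hx
  obtain ⟨t1, t2⟩ := ht
  have h1 := S.eq₁ _ hz
  have h2 := S.pd0_f22_mul hz
  have r1 : res 3 Z 1 = Z 1 := rfl
  have r2 : res 3 Z 2 = Z 2 := rfl
  rw [r1] at h1 h2
  rw [r2] at h1
  have hX : coareaX η f Z = η * (pd 0 (f 0 0) (res 3 Z) * F (res 3 Z)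
      + (f 2 0 (res 3 Z) * f 1 1 (res 3 Z) - f 2 1 (res 3 Z) * η))
      - pd 0 (f 0 0) (res 3 Z) * Z 1 * f 1 1 (res 3 Z)
      - f 0 0 (res 3 Z)
        * (f 0 0 (res 3 Z) * f 2 1 (res 3 Z) - f 0 1 (res 3 Z) * f 2 0 (res 3 Z)) := by
    rw [coareaX]
    linear_combination η * h1 - f 0 0 (res 3 Z) * h2
  have H1 : η * (coarea η f (res 3 Z) * Dx a x t Z + a (jetPoint m x t Z) * coareaX η f Z)
      = (2 * b (jetPoint m x t Z) * η + a (jetPoint m x t Z) * f 0 0 (res 3 Z))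
        * f 2 0 (res 3 Z) * coarea η f (res 3 Z) := by
    rw [hX, coarea]
    linear_combination η * (η * (E1 + t1) - f 1 1 (res 3 Z) * x1)
      + (f 2 0 (res 3 Z) * f 1 1 (res 3 Z) - f 2 1 (res 3 Z) * η) * h0
  refine ⟨H1, ?_⟩
  rw [hX] at H1 ⊢
  rw [coarea] at H1 ⊢
  linear_combination η * (η * (η * E2 + t2) - f 1 1 (res 3 Z) * x2
      - (η * f 0 1 (res 3 Z) - f 0 0 (res 3 Z) * f 1 1 (res 3 Z)) * x1)
    + f 0 0 (res 3 Z) * H1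
    - η * (f 0 0 (res 3 Z) * f 2 1 (res 3 Z) - f 0 1 (res 3 Z) * f 2 0 (res 3 Z)) * h0

end Degenerate

end IsSecondFundamentalForm

end

/-! ### Independence of the second fundamental form from the jet variables. -/

section

variable {η : ℝ} {U : Set (Fin 3 → ℝ)} {f : Coeffs} {F : (Fin 3 → ℝ) → ℝ}
  {m : ℕ} {W : Set (JetSpace m)} {a b c : JetSpace m → ℝ} {x t : ℝ} {Z : ℕ → ℝ}

lemma line_apply_of_ne {ι : Type*} [DecidableEq ι] {i j : ι} (h : i ≠ j) (Z : ι → ℝ) (s : ℝ) :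
    line j Z s i = Z i := by
  simp [line, h]

lemma StructureIdentities.jetLine_f (S : StructureIdentities η U f F) (hz : res 3 Z ∈ U)
    (i : Fin 3) (l : Fin 2) (j : ℕ) :
    HasDerivAt (fun s => f i l (res 3 (line (j + 2) Z s))) 0 0 := by
  cases j with
  | zero =>
    simp only [zero_add, res_line_two]
    have h : pd 2 (f i l) (res 3 Z) = 0 := by
      fin_cases l
      · exact S.pd2_dx i _ hz
      · exact S.pd2_dt i _ hz
    simpa [h] using S.line_f i l 2 hz
  | succ j =>
    simp only [res_line_of_le (show 3 ≤ j + 1 + 2 by omega)]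
    exact hasDerivAt_const _ _

/-- The function does not depend on the jet variables `z_j` with `j > k`. -/
def IndepAbove (W : Set (JetSpace m)) (k : ℕ) (a : JetSpace m → ℝ) : Prop :=
  ∀ j, k < j → ∀ q ∈ W, fderiv ℝ a q (vert m j) = 0

lemma coarea_eq_neg_area (S : StructureIdentities η U f F) {z : Fin 3 → ℝ} (hz : z ∈ U) :
    area f z = -coarea η f z := by
  rw [area, wedge, coarea, S.f21 z hz]
  ring

namespace IsSecondFundamentalForm

/-- In the z_{k+2}-derivative of the Codazzi equations only the D_t terms survive, each with the
factor G ≠ 0: D_x a, D_x b, D_x c reach at most z_{k+1}, and the f_{ij} at most z₁. -/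
lemma vert_relations (S : StructureIdentities η U f F)
    (H : IsSecondFundamentalForm U f F W a b c) {k : ℕ} (ha : IndepAbove W k a)
    (hb : IndepAbove W k b) (hc : IndepAbove W k c) (hq : jetPoint m x t Z ∈ W) :
    f 0 0 (res 3 Z) * fderiv ℝ a (jetPoint m x t Z) (vert m k)
      + η * fderiv ℝ b (jetPoint m x t Z) (vert m k) = 0 ∧
    f 0 0 (res 3 Z) * fderiv ℝ b (jetPoint m x t Z) (vert m k)
      + η * fderiv ℝ c (jetPoint m x t Z) (vert m k) = 0 := by
  have hz : res 3 Z ∈ U := H.base_mem_jetPoint hq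
  have hG := S.pd_F_ne _ hz
  have A (i l) := S.jetLine_f hz i l k
  have fn {g : JetSpace m → ℝ} (hg : ContDiffOn ℝ ∞ g W) (h : IndepAbove W k g) :
      HasDerivAt (fun s => g (jetPoint m x t (line (k + 2) Z s))) 0 0 := by
    have := hasDerivAt_jetLine H.isOpen hg hq (k + 2)
    rwa [h (k + 2) (by omega) _ hq] at this
  have fx {g : JetSpace m → ℝ} (hg : ContDiffOn ℝ ∞ g W) (h : IndepAbove W k g) :
      HasDerivAt (fun s => Dx g x t (line (k + 2) Z s)) 0 0 := by
    have := hasDerivAt_Dx H.isOpen hg hq (j := k + 1) (h (k + 2) (by omega))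
    rwa [h (k + 1) (by omega) _ hq] at this
  have ft {g : JetSpace m → ℝ} (hg : ContDiffOn ℝ ∞ g W) (h : IndepAbove W k g) :=
    hasDerivAt_Dt S.isOpen S.smooth_F hz H.isOpen hg hq h
  have e1 := deriv_eq_of_jetLine H.isOpen hq (k + 2)
    (((((((A 0 1).fun_mul (fx H.smooth_a ha)).fun_sub ((A 0 0).fun_mul (ft H.smooth_a ha))).fun_add
      ((A 1 1).fun_mul (fx H.smooth_b hb))).fun_sub ((ft H.smooth_b hb).const_mul η)).fun_add
      (((fn H.smooth_b hb).const_mul 2).fun_mul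
        (((A 0 0).fun_mul (A 2 1)).fun_sub ((A 0 1).fun_mul (A 2 0))))).fun_add
      (((fn H.smooth_a ha).fun_sub (fn H.smooth_c hc)).fun_mul
        (((A 2 0).fun_mul (A 1 1)).fun_sub ((A 2 1).mul_const η))))
    (hasDerivAt_const (0 : ℝ) (0 : ℝ)) (fun s hs => H.codazzi₁_expanded S hs)
  have e2 := deriv_eq_of_jetLine H.isOpen hq (k + 2)
    (((((((A 0 1).fun_mul (fx H.smooth_b hb)).fun_sub ((A 0 0).fun_mul (ft H.smooth_b hb))).fun_add
      ((A 1 1).fun_mul (fx H.smooth_c hc))).fun_sub ((ft H.smooth_c hc).const_mul η)).fun_add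
      (((fn H.smooth_b hb).const_mul 2).fun_mul
        (((A 2 0).fun_mul (A 1 1)).fun_sub ((A 2 1).mul_const η)))).fun_add
      (((fn H.smooth_c hc).fun_sub (fn H.smooth_a ha)).fun_mul
        (((A 0 0).fun_mul (A 2 1)).fun_sub ((A 0 1).fun_mul (A 2 0)))))
    (hasDerivAt_const (0 : ℝ) (0 : ℝ)) (fun s hs => H.codazzi₂_expanded S hs)
  simp only [line_zero] at e1 e2
  exact ⟨mul_left_cancel₀ hG (by linear_combination -e1),
    mul_left_cancel₀ hG (by linear_combination -e2)⟩

/-- If the Codazzi equations degenerate on `O`, then `ω¹ ∧ ω² = 0` wherever `∂a/∂z_k ≠ 0`. -/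
lemma coarea_mul_eq_zero (S : StructureIdentities η U f F) (hη : η ≠ 0)
    (H : IsSecondFundamentalForm U f F W a b c) {k : ℕ} (ha : IndepAbove W k a)
    (hb : IndepAbove W k b) {O : Set (JetSpace m)} (hO : IsOpen O) (hOW : O ⊆ W)
    (hdeg : ∀ q ∈ O, c q * η ^ 2 + 2 * b q * η * f 0 0 (base q) + f 0 0 (base q) ^ 2 * a q = 0)
    (hq : jetPoint m x t Z ∈ O) :
    coarea η f (res 3 Z) * fderiv ℝ a (jetPoint m x t Z) (vert m k) = 0 := by
  have H12 {Z : ℕ → ℝ} (hq : jetPoint m x t Z ∈ O) :=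
    H.coareaX_of_degenerate S hη hO hOW hdeg hq
  have hqW := hOW hq
  have hz : res 3 Z ∈ U := H.base_mem_jetPoint hqW
  have fn {g : JetSpace m → ℝ} (hg : ContDiffOn ℝ ∞ g W) (h : IndepAbove W k g) {j : ℕ}
      (hj : k < j) : HasDerivAt (fun s => g (jetPoint m x t (line j Z s))) 0 0 := by
    have := hasDerivAt_jetLine H.isOpen hg hqW j
    rwa [h j hj _ hqW] at this
  have fx : HasDerivAt (fun s => Dx a x t (line (k + 1) Z s))
      (fderiv ℝ a (jetPoint m x t Z) (vert m k)) 0 :=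
    hasDerivAt_Dx H.isOpen H.smooth_a hqW (ha (k + 1) (by omega))
  refine mul_left_cancel₀ hη ?_
  by_cases hk : 2 ≤ k
  -- As k + 1 ≥ 3, z_{k+1} is absent from `coarea` and `coareaX`, so D_x a alone contributes.
  · have e := deriv_eq_of_jetLine hO hq (k + 1)
      (((fx.const_mul (coarea η f (res 3 Z))).fun_add
        ((fn H.smooth_a ha (show k < k + 1 by omega)).mul_const (coareaX η f Z))).const_mul η)
      ((((((fn H.smooth_b hb (show k < k + 1 by omega)).const_mul 2).mul_const η).fun_add
        ((fn H.smooth_a ha (show k < k + 1 by omega)).mul_const (f 0 0 (res 3 Z)))).mul_const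
          (f 2 0 (res 3 Z))).mul_const (coarea η f (res 3 Z)))
      (fun s hs => by
        have h := (H12 hs).1
        simp only [coareaX, res_line_of_le (show 3 ≤ k + 1 by omega),
          line_apply_of_ne (show 1 ≠ k + 1 by omega),
          line_apply_of_ne (show 2 ≠ k + 1 by omega)] at h
        rw [coareaX]
        exact h)
    linear_combination e
  have hcoarea {Z : ℕ → ℝ} (hz : res 3 Z ∈ U) :
      HasDerivAt (fun s => coarea η f (res 3 (line 2 Z s))) 0 0 := by
    have h := ((S.jetLine_f hz 0 1 0).const_mul η).fun_sub
      ((S.jetLine_f hz 0 0 0).fun_mul (S.jetLine_f hz 1 1 0))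
    simpa [coarea] using h
  have hcoareaX {Z : ℕ → ℝ} (hz : res 3 Z ∈ U) :
      HasDerivAt (fun s => coareaX η f (line 2 Z s)) (η * pd 1 (f 0 1) (res 3 Z)) 0 := by
    have h := (((((S.line_pd 0 1 0 2 hz).mul_const (Z 1)).fun_add
        ((S.line_pd 0 1 1 2 hz).fun_mul (hasDerivAt_line_apply 2 Z 2))).const_mul η).fun_sub
        (((S.line_pd 0 0 0 2 hz).mul_const (Z 1)).fun_mul (S.line_f 1 1 2 hz))).fun_sub
        ((S.line_f 0 0 2 hz).fun_mul ((S.line_pd 1 1 0 2 hz).mul_const (Z 1)))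
    simpa [coareaX, res_line_two, line_apply_of_ne, S.pd2_pd_dx _ _ hz, S.pd2_pd_dt _ _ hz,
      S.pd2_dx _ _ hz, S.pd2_dt _ _ hz] using h
  -- For k < 2 the second relation contains z₂ only through `coareaX`, with coefficient η f₁₂,₁, and
  -- its prefactor 2(af₁₁ + bη)η is nonzero.
  have hf12 {Z : ℕ → ℝ} (hq : jetPoint m x t Z ∈ O) : pd 1 (f 0 1) (res 3 Z) = 0 := by
    have hqW := hOW hq
    have hz : res 3 Z ∈ U := H.base_mem_jetPoint hqW
    have B (i l) : HasDerivAt (fun s => f i l (res 3 (line 2 Z s))) 0 0 := S.jetLine_f hz i l 0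
    have fn {g : JetSpace m → ℝ} (hg : ContDiffOn ℝ ∞ g W) (h : IndepAbove W k g) :
        HasDerivAt (fun s => g (jetPoint m x t (line 2 Z s))) 0 0 := by
      have := hasDerivAt_jetLine H.isOpen hg hqW 2
      rwa [h 2 (by omega) _ hqW] at this
    have hδ := ((fn H.smooth_a ha).fun_mul (B 0 0)).fun_add ((fn H.smooth_b hb).mul_const η)
    have e := deriv_eq_of_jetLine hO hq 2
      (((hδ.const_mul 2).mul_const η).fun_mul (hcoareaX hz))
      ((((fn H.smooth_a ha).fun_mul (hcoarea hz)).fun_mul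
          ((((S.line_pd 0 0 0 2 hz).mul_const (Z 1)).const_mul η).fun_sub
            ((((B 0 0).fun_pow 2).const_add (η ^ 2)).fun_mul (B 2 0)))).fun_add
        ((((hδ.const_mul 2).fun_mul (B 0 0)).fun_mul (B 2 0)).fun_mul (hcoarea hz)))
      (fun s hs => by
        have h := (H12 hs).2
        rw [line_apply_of_ne (show 1 ≠ 2 by omega)] at h
        rw [← res_line_two]
        linear_combination h)
    simp only [line_zero, S.pd2_pd_dx _ _ hz] at e
    have hsq := H.sq_eq_of_degenerate S hOW hdeg hq
    rw [base_jetPoint, S.f21 _ hz] at hsq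
    have hne : a (jetPoint m x t Z) * f 0 0 (res 3 Z) + b (jetPoint m x t Z) * η ≠ 0 :=
      fun h0 => pow_ne_zero 2 hη (by rw [← hsq, h0]; ring)
    refine mul_left_cancel₀ (mul_ne_zero (mul_ne_zero hne hη) hη) ?_
    linear_combination e / 2
  have hf11 {Z : ℕ → ℝ} (hq : jetPoint m x t Z ∈ O) : pd 0 (f 0 0) (res 3 Z) = 0 := by
    have hz : res 3 Z ∈ U := H.base_mem_jetPoint (hOW hq)
    have h := S.pd1_f12 hz
    rw [hf12 hq] at h
    exact (mul_eq_zero.1 h.symm).resolve_right (S.pd_F_ne _ hz)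
  interval_cases k
  -- Case k = 0. Now `coareaX` is z₁ times a factor independent of z₁, and `coarea` is independent
  -- of z₁. The z₁-derivative of the second relation kills that factor, and then that of the first
  -- leaves `coarea` times ∂a/∂z₀.
  · have B (i l) : HasDerivAt (fun s => f i l (res 3 (line 1 Z s))) (pd 1 (f i l) (res 3 Z)) 0 := by
      simp only [res_line_one]
      exact S.line_f i l 1 hz
    have B1 : HasDerivAt (fun s => coarea η f (res 3 (line 1 Z s))) 0 0 := by
      have h := ((B 0 1).const_mul η).fun_sub ((B 0 0).fun_mul (B 1 1))
      simpa [coarea, hf12 hq, S.pd1_dx _ _ hz, S.pd1_f22 hz] using h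
    have hδ := ((fn H.smooth_a ha one_pos).fun_mul (B 0 0)).fun_add
      ((fn H.smooth_b hb one_pos).mul_const η)
    have C {Z : ℕ → ℝ} (hq : jetPoint m x t Z ∈ O) :
        coareaX η f Z
          = (η * pd 0 (f 0 1) (res 3 Z) - f 0 0 (res 3 Z) * pd 0 (f 1 1) (res 3 Z)) * Z 1 := by
      rw [coareaX, hf12 hq, hf11 hq]
      ring
    have hpp : pd 1 (pd 0 (f 0 1)) (res 3 Z) = 0 := by
      rw [S.pd1_pd0_f12 hz, hf11 hq]
      have h := deriv_eq_of_jetLine hO hq 0 (S.line_pd 0 0 0 0 hz)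
        (hasDerivAt_const (0 : ℝ) (0 : ℝ)) (fun s hs => by rw [← res_line_zero]; exact hf11 hs)
      rw [h]
      ring
    have C1 : HasDerivAt (fun s =>
        (η * pd 0 (f 0 1) (res 3 (line 1 Z s))
          - f 0 0 (res 3 (line 1 Z s)) * pd 0 (f 1 1) (res 3 (line 1 Z s))) * line 1 Z s 1)
        (η * pd 0 (f 0 1) (res 3 Z) - f 0 0 (res 3 Z) * pd 0 (f 1 1) (res 3 Z)) 0 := by
      simp only [res_line_one]
      have h := (((S.line_pd 0 1 0 1 hz).const_mul η).fun_sub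
        ((S.line_f 0 0 1 hz).fun_mul (S.line_pd 1 1 0 1 hz))).fun_mul
          (hasDerivAt_line_apply 1 Z 1)
      simpa [hpp, S.pd1_dx _ _ hz, S.pd1_pd_f22 _ hz] using h
    have e2 := deriv_eq_of_jetLine hO hq 1
      (((hδ.const_mul 2).mul_const η).fun_mul C1)
      ((((fn H.smooth_a ha one_pos).fun_mul B1).fun_mul
          ((((B 0 0).fun_pow 2).const_add (η ^ 2)).fun_mul (B 2 0)).fun_neg).fun_add
        ((((hδ.const_mul 2).fun_mul (B 0 0)).fun_mul (B 2 0)).fun_mul B1))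
      (fun s hs => by
        have h := (H12 hs).2
        rw [C hs, hf11 hs] at h
        linear_combination h)
    simp only [line_zero, S.pd1_dx _ _ hz] at e2
    have hsq := H.sq_eq_of_degenerate S hOW hdeg hq
    rw [base_jetPoint, S.f21 _ hz] at hsq
    have hne : a (jetPoint m x t Z) * f 0 0 (res 3 Z) + b (jetPoint m x t Z) * η ≠ 0 :=
      fun h0 => pow_ne_zero 2 hη (by rw [← hsq, h0]; ring)
    have hX : η * pd 0 (f 0 1) (res 3 Z) - f 0 0 (res 3 Z) * pd 0 (f 1 1) (res 3 Z) = 0 := by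
      refine mul_left_cancel₀ (mul_ne_zero hne hη) ?_
      linear_combination e2 / 2
    rw [hX] at C1
    have e1 := deriv_eq_of_jetLine hO hq 1
      (((B1.fun_mul fx).fun_add ((fn H.smooth_a ha one_pos).fun_mul C1)).const_mul η)
      ((((((fn H.smooth_b hb one_pos).const_mul 2).mul_const η).fun_add
        ((fn H.smooth_a ha one_pos).fun_mul (B 0 0))).fun_mul (B 2 0)).fun_mul B1)
      (fun s hs => by
        have h := (H12 hs).1
        rw [C hs] at h
        exact h)
    simp only [zero_add, line_zero, S.pd1_dx _ _ hz] at e1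
    linear_combination e1
  -- Case k = 1. With f₁₂,₁ = 0, z₂ enters the first relation only through D_x a.
  · have B (i l) : HasDerivAt (fun s => f i l (res 3 (line 2 Z s))) 0 0 := S.jetLine_f hz i l 0
    have e1 := deriv_eq_of_jetLine hO hq 2
      ((((hcoarea hz).fun_mul fx).fun_add
        ((fn H.smooth_a ha one_lt_two).fun_mul (hcoareaX hz))).const_mul η)
      ((((((fn H.smooth_b hb one_lt_two).const_mul 2).mul_const η).fun_add
        ((fn H.smooth_a ha one_lt_two).fun_mul (B 0 0))).fun_mul (B 2 0)).fun_mul (hcoarea hz))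
      (fun s hs => (H12 hs).1)
    simp only [line_zero, hf12 hq] at e1
    linear_combination e1

lemma vert_eq_zero_step (S : StructureIdentities η U f F) (hη : η ≠ 0)
    (H : IsSecondFundamentalForm U f F W a b c) {k : ℕ} (ha : IndepAbove W k a)
    (hb : IndepAbove W k b) (hc : IndepAbove W k c) {q : JetSpace m} (hq : q ∈ W) :
    fderiv ℝ a q (vert m k) = 0 ∧ fderiv ℝ b q (vert m k) = 0 ∧ fderiv ℝ c q (vert m k) = 0 := by
  have rel {q : JetSpace m} (hq : q ∈ W) :
      f 0 0 (base q) * fderiv ℝ a q (vert m k) + η * fderiv ℝ b q (vert m k) = 0 ∧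
      f 0 0 (base q) * fderiv ℝ b q (vert m k) + η * fderiv ℝ c q (vert m k) = 0 := by
    obtain ⟨Z, hZ⟩ := exists_jetPoint_eq q
    rw [hZ] at hq ⊢
    exact H.vert_relations S ha hb hc hq
  have ha0 : ∀ q ∈ W, fderiv ℝ a q (vert m k) = 0 := by
    by_contra! hne
    obtain ⟨q, hq, hqne⟩ := hne
    set O := W ∩ {q | fderiv ℝ a q (vert m k) ≠ 0}
    have hO : IsOpen O := (contDiffOn_fderiv_apply H.isOpen H.smooth_a _).continuousOn
      |>.isOpen_inter_preimage H.isOpen isOpen_ne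
    have hOW : O ⊆ W := Set.inter_subset_left
    -- `rel` makes the derivatives of b and c the multiples −f₁₁/η and f₁₁²/η² of that of a. The
    -- differentiated Gauss equation then has the nonzero common factor ∂a/∂z_k.
    have hdeg : ∀ q ∈ O,
        c q * η ^ 2 + 2 * b q * η * f 0 0 (base q) + f 0 0 (base q) ^ 2 * a q = 0 := by
      intro q hq
      obtain ⟨r1, r2⟩ := rel hq.1
      have hg := fderiv_eq_zero_of_eqOn_const H.isOpen (g := fun q => a q * c q - b q * b q)
        (fun p hp => (by rw [← sq]; exact H.gauss p hp)) hq.1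
      have da := (differentiableAt_of_smooth H.isOpen H.smooth_a hq.1).hasFDerivAt
      have db := (differentiableAt_of_smooth H.isOpen H.smooth_b hq.1).hasFDerivAt
      have dc := (differentiableAt_of_smooth H.isOpen H.smooth_c hq.1).hasFDerivAt
      rw [((da.fun_mul dc).fun_sub (db.fun_mul db)).fderiv] at hg
      have hg' := congrArg (fun L : JetSpace m →L[ℝ] ℝ => L (vert m k)) hg
      simp only [sub_apply, add_apply, smul_apply, smul_eq_mul, zero_apply] at hg'
      have hne : fderiv ℝ a q (vert m k) ≠ 0 := hq.2
      refine mul_left_cancel₀ hne ?_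
      linear_combination η ^ 2 * hg' + (2 * η * b q + a q * f 0 0 (base q)) * r1 - a q * η * r2
    obtain ⟨z, ⟨p, hp, rfl⟩, hz⟩ := S.exists_area_ne_zero (V := base '' O)
      (isOpenMap_base O hO) (by rintro _ ⟨p, hp, rfl⟩; exact H.base_mem p (hOW hp))
      ⟨q, ⟨hq, hqne⟩, rfl⟩
    rw [coarea_eq_neg_area S (H.base_mem p (hOW hp)), neg_ne_zero] at hz
    obtain ⟨Z, hZ⟩ := exists_jetPoint_eq p
    have h := H.coarea_mul_eq_zero S hη ha hb hO hOW hdeg (hZ ▸ hp)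
    rw [← base_jetPoint (m := m) (x := p.1) (t := p.2.1), ← hZ] at h
    exact mul_ne_zero hz hp.2 h
  obtain ⟨r1, r2⟩ := rel hq
  have hb0 : fderiv ℝ b q (vert m k) = 0 := by
    rw [ha0 q hq] at r1
    simpa [hη] using r1
  rw [hb0] at r2
  exact ⟨ha0 q hq, hb0, by simpa [hη] using r2⟩

/-- The coefficients of the second fundamental form do not depend on the jet variables. -/
theorem vert_eq_zero (S : StructureIdentities η U f F) (hη : η ≠ 0)
    (H : IsSecondFundamentalForm U f F W a b c) {q : JetSpace m} (hq : q ∈ W) (k : ℕ) :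
    fderiv ℝ a q (vert m k) = 0 ∧ fderiv ℝ b q (vert m k) = 0 ∧ fderiv ℝ c q (vert m k) = 0 := by
  -- Downward induction on k: beyond the order of the jets `vert m k` is 0, and n bounds the
  -- distance from there.
  suffices h : ∀ n k, 3 + m ≤ k + n → ∀ q ∈ W, fderiv ℝ a q (vert m k) = 0 ∧
      fderiv ℝ b q (vert m k) = 0 ∧ fderiv ℝ c q (vert m k) = 0 from
    h (3 + m) k (by omega) q hq
  intro n
  induction n with
  | zero =>
    intro k hk q _
    simp [vert_of_le (show 3 + m ≤ k from hk)]
  | succ n ih =>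
    intro k hk q hq
    exact H.vert_eq_zero_step S hη
      (fun j hj p hp => (ih j (by omega) p hp).1)
      (fun j hj p hp => (ih j (by omega) p hp).2.1)
      (fun j hj p hp => (ih j (by omega) p hp).2.2) hq

end IsSecondFundamentalForm

end

/-! ### Passing between the structure equations for functions u(x, t) and identities on U. -/

section

section SpaceJet

variable {u : ℝ → ℝ → ℝ}

lemma exists_smooth_iteratedDeriv (hu : ContDiff ℝ ∞ (fun p : ℝ × ℝ => u p.1 p.2)) (n : ℕ) :
    ∃ v : ℝ × ℝ → ℝ, ContDiff ℝ ∞ v ∧ ∀ x t, iteratedDeriv n (fun y => u y t) x = v (x, t) := by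
  induction n with
  | zero => exact ⟨_, hu, fun x t => by simp⟩
  | succ n ih =>
    obtain ⟨v, hv, h⟩ := ih
    refine ⟨fun p => fderiv ℝ v p (1, 0), (hv.fderiv_right (m := ∞) (by simp)).clm_apply
      contDiff_const, fun x t => ?_⟩
    rw [iteratedDeriv_succ, show iteratedDeriv n (fun y => u y t) = fun y => v (y, t) from
      funext fun y => h y t]
    have h1 : HasFDerivAt v (fderiv ℝ v (x, t)) (x, t) :=
      (hv.differentiable (by simp) _).hasFDerivAt
    have h2 : HasDerivAt (fun y : ℝ => (y, t)) (1, 0) x :=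
      (hasDerivAt_id x).prodMk (hasDerivAt_const x t)
    exact (h1.comp_hasDerivAt x h2).deriv

lemma hasDerivAt_spaceJet_x (hu : ContDiff ℝ ∞ (fun p : ℝ × ℝ => u p.1 p.2)) (x t : ℝ) :
    HasDerivAt (fun y => spaceJet u y t)
      (fun i : Fin 3 => iteratedDeriv (i + 1) (fun y => u y t) x) x := by
  refine hasDerivAt_pi.2 fun i => ?_
  have h : ContDiff ℝ ∞ fun y => u y t := hu.comp (contDiff_id.prodMk contDiff_const)
  rw [iteratedDeriv_succ]
  exact (h.differentiable_iteratedDeriv i (by exact_mod_cast WithTop.coe_lt_top _) x).hasDerivAt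

lemma exists_hasDerivAt_spaceJet_t (hu : ContDiff ℝ ∞ (fun p : ℝ × ℝ => u p.1 p.2)) (x t : ℝ) :
    ∃ τ : Fin 3 → ℝ, HasDerivAt (fun s => spaceJet u x s) τ t ∧
      τ 0 = deriv (fun s => u x s) t := by
  choose v hv h using exists_smooth_iteratedDeriv hu
  refine ⟨fun i => deriv (fun s => v i (x, s)) t, hasDerivAt_pi.2 fun i => ?_, ?_⟩
  · simp only [spaceJet, h]
    have : Differentiable ℝ fun s => v i (x, s) :=
      ((hv i).comp (contDiff_const.prodMk contDiff_id)).differentiable (by simp)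
    exact (this t).hasDerivAt
  · simp only [← h]
    simp

end SpaceJet

variable {η : ℝ} {U : Set (Fin 3 → ℝ)} {f : Coeffs} {F : (Fin 3 → ℝ) → ℝ}

lemma extD_spaceJet (hU : IsOpen U) (hf : ∀ i j, ContDiffOn ℝ ∞ (f i j) U) {u : ℝ → ℝ → ℝ}
    {x t : ℝ} (hz : spaceJet u x t ∈ U) {σ τ : Fin 3 → ℝ}
    (hσ : HasDerivAt (fun y => spaceJet u y t) σ x)
    (hτ : HasDerivAt (fun s => spaceJet u x s) τ t) (i : Fin 3) :
    extD (fun y s => f i 0 (spaceJet u y s)) (fun y s => f i 1 (spaceJet u y s)) x t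
      = fderiv ℝ (f i 1) (spaceJet u x t) σ - fderiv ℝ (f i 0) (spaceJet u x t) τ := by
  have h1 := (differentiableAt_of_smooth hU (hf i 1) hz).hasFDerivAt.comp_hasDerivAt x hσ
  have h0 := (differentiableAt_of_smooth hU (hf i 0) hz).hasFDerivAt.comp_hasDerivAt t hτ
  rw [extD]
  exact congrArg₂ (· - ·) h1.deriv h0.deriv

lemma structureAt_iff (hU : IsOpen U) (hf : ∀ i j, ContDiffOn ℝ ∞ (f i j) U) {u : ℝ → ℝ → ℝ}
    {x t : ℝ} (hz : spaceJet u x t ∈ U) {σ τ : Fin 3 → ℝ}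
    (hσ : HasDerivAt (fun y => spaceJet u y t) σ x)
    (hτ : HasDerivAt (fun s => spaceJet u x s) τ t) {z : Fin 3 → ℝ} (hzz : spaceJet u x t = z) :
    StructureAt f u x t ↔
      (fderiv ℝ (f 0 1) z σ - fderiv ℝ (f 0 0) z τ = f 2 0 z * f 1 1 z - f 2 1 z * f 1 0 z ∧
      fderiv ℝ (f 1 1) z σ - fderiv ℝ (f 1 0) z τ = f 0 0 z * f 2 1 z - f 0 1 z * f 2 0 z ∧
      fderiv ℝ (f 2 1) z σ - fderiv ℝ (f 2 0) z τ = f 0 0 z * f 1 1 z - f 0 1 z * f 1 0 z) := by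
  subst hzz
  simp only [StructureAt, wedge, extD_spaceJet hU hf hz hσ hτ]

/-- There are smooth functions with prescribed derivatives `∂_x^i u`, `i ≤ 3`, and
`∂_x^i ∂_t u`, `i ≤ 2`, at the origin. -/
lemma exists_function_with_jet (z τ : Fin 3 → ℝ) (z₃ : ℝ) :
    ∃ u : ℝ → ℝ → ℝ, ContDiff ℝ ∞ (fun p : ℝ × ℝ => u p.1 p.2) ∧ spaceJet u 0 0 = z ∧
      HasDerivAt (fun y => spaceJet u y 0) ![z 1, z 2, z₃] 0 ∧
      HasDerivAt (fun s => spaceJet u 0 s) τ 0 ∧ deriv (fun s => u 0 s) 0 = τ 0 := by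
  let u : ℝ → ℝ → ℝ := fun y s => z 0 + z 1 * y + z 2 / 2 * y ^ 2 + z₃ / 6 * y ^ 3
    + s * (τ 0 + τ 1 * y + τ 2 / 2 * y ^ 2)
  have d1 (s : ℝ) : deriv (fun y => u y s)
      = fun y => z 1 + z 2 * y + z₃ / 2 * y ^ 2 + s * (τ 1 + τ 2 * y) := by
    funext y
    have h := ((((hasDerivAt_const y (z 0)).fun_add ((hasDerivAt_id y).const_mul (z 1))).fun_add
      (((hasDerivAt_id y).fun_pow 2).const_mul (z 2 / 2))).fun_add
      (((hasDerivAt_id y).fun_pow 3).const_mul (z₃ / 6))).fun_add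
      ((((hasDerivAt_const y (τ 0)).fun_add ((hasDerivAt_id y).const_mul (τ 1))).fun_add
      (((hasDerivAt_id y).fun_pow 2).const_mul (τ 2 / 2))).const_mul s)
    refine h.deriv.trans ?_
    simp
    ring
  have d2 (s : ℝ) : deriv (fun y => z 1 + z 2 * y + z₃ / 2 * y ^ 2 + s * (τ 1 + τ 2 * y))
      = fun y => z 2 + z₃ * y + s * τ 2 := by
    funext y
    have h := (((hasDerivAt_const y (z 1)).fun_add ((hasDerivAt_id y).const_mul (z 2))).fun_add
      (((hasDerivAt_id y).fun_pow 2).const_mul (z₃ / 2))).fun_add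
      (((hasDerivAt_const y (τ 1)).fun_add ((hasDerivAt_id y).const_mul (τ 2))).const_mul s)
    refine h.deriv.trans ?_
    simp
    ring
  have hj (y s : ℝ) : spaceJet u y s = ![u y s,
      z 1 + z 2 * y + z₃ / 2 * y ^ 2 + s * (τ 1 + τ 2 * y), z 2 + z₃ * y + s * τ 2] := by
    ext i
    fin_cases i
    · simp [spaceJet]
    · simp [spaceJet, d1]
    · simp [spaceJet, iteratedDeriv_succ, d1, d2]
  have hu : ContDiff ℝ ∞ (fun p : ℝ × ℝ => u p.1 p.2) := by fun_prop
  have hτ : HasDerivAt (fun s => spaceJet u 0 s) τ 0 := by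
    refine hasDerivAt_pi.2 fun i => ?_
    simp only [hj]
    have id0 := hasDerivAt_id (0 : ℝ)
    fin_cases i
    · simpa [u] using (id0.mul_const (τ 0)).const_add (z 0)
    · simpa using (id0.mul_const (τ 1)).const_add (z 1)
    · simpa using (id0.mul_const (τ 2)).const_add (z 2)
  refine ⟨u, hu, ?_, ?_, hτ, ?_⟩
  · rw [hj]
    ext i
    fin_cases i <;> simp [u]
  · have h := hasDerivAt_spaceJet_x hu 0 0
    have h3 : iteratedDeriv 3 (fun y => u y 0) 0 = z₃ := by
      simp only [iteratedDeriv_succ, iteratedDeriv_zero, d1, d2]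
      simp
    have h2 : iteratedDeriv 2 (fun y => u y 0) 0 = z 2 := by
      simp only [iteratedDeriv_succ, iteratedDeriv_zero, d1, d2]
      simp
    convert h using 1
    ext i
    fin_cases i
    · simp [d1]
    · simp [h2]
    · simp [h3]
  · have h := (hasDerivAt_pi.1 hτ 0).deriv
    simpa [spaceJet] using h

/-- At a 2-jet z the values u_xxx and ∂_t of u, u_x, u_xx are free parameters. The structure
equations are affine in them, so the coefficients can be compared. -/
theorem DescribesPSS.structureIdentities (hU : IsOpen U) (hF : ContDiffOn ℝ ∞ F U)
    (hF2 : ∀ z ∈ U, pd 2 F z ≠ 0) (hf : ∀ i j, ContDiffOn ℝ ∞ (f i j) U)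
    (H : DescribesPSS η U f F) : StructureIdentities η U f F := by
  obtain ⟨h21, hdense, hiff⟩ := H
  have d10 (k) {z} (hz : z ∈ U) : pd k (f 1 0) z = 0 := pd_eq_zero_of_eqOn_const hU h21 hz k
  have key {z : Fin 3 → ℝ} (hz : z ∈ U) (τ : Fin 3 → ℝ) (z₃ : ℝ) :
      ((z 1 * pd 0 (f 0 1) z + z 2 * pd 1 (f 0 1) z + z₃ * pd 2 (f 0 1) z)
          - (τ 0 * pd 0 (f 0 0) z + τ 1 * pd 1 (f 0 0) z + τ 2 * pd 2 (f 0 0) z)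
          = f 2 0 z * f 1 1 z - f 2 1 z * η ∧
        (z 1 * pd 0 (f 1 1) z + z 2 * pd 1 (f 1 1) z + z₃ * pd 2 (f 1 1) z)
          = f 0 0 z * f 2 1 z - f 0 1 z * f 2 0 z ∧
        (z 1 * pd 0 (f 2 1) z + z 2 * pd 1 (f 2 1) z + z₃ * pd 2 (f 2 1) z)
          - (τ 0 * pd 0 (f 2 0) z + τ 1 * pd 1 (f 2 0) z + τ 2 * pd 2 (f 2 0) z)
          = f 0 0 z * f 1 1 z - f 0 1 z * η) ↔ τ 0 = F z := by
    obtain ⟨u, hu, hj, hσ, hτ, ht⟩ := exists_function_with_jet z τ z₃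
    have h := hiff u hu 0 0 (hj ▸ hz)
    rw [structureAt_iff hU hf (hj ▸ hz) hσ hτ hj, ht, hj] at h
    simpa [fderiv_apply_eq_sum, d10 _ hz, h21 z hz] using h
  have base {z} (hz : z ∈ U) := (key hz ![F z, 0, 0] 0).2 rfl
  have shift₁ {z} (hz : z ∈ U) := (key hz ![F z, 1, 0] 0).2 rfl
  have shift₂ {z} (hz : z ∈ U) := (key hz ![F z, 0, 1] 0).2 rfl
  have shift₃ {z} (hz : z ∈ U) := (key hz ![F z, 0, 0] 1).2 rfl
  simp only [Matrix.cons_val_zero, Matrix.cons_val_one, Matrix.cons_val, zero_mul, one_mul,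
    add_zero] at base shift₁ shift₂ shift₃
  refine ⟨hU, hF, hf, hF2, h21, hdense, fun i z hz => ?_, fun i z hz => ?_, fun i z hz => ?_,
    fun z hz => ?_, fun z hz => ?_, fun z hz => ?_, fun z hz => ?_⟩
  · fin_cases i
    · change pd 1 (f 0 0) z = 0
      linear_combination (base hz).1 - (shift₁ hz).1
    · exact d10 _ hz
    · change pd 1 (f 2 0) z = 0
      linear_combination (base hz).2.2 - (shift₁ hz).2.2
  · fin_cases i
    · change pd 2 (f 0 0) z = 0
      linear_combination (base hz).1 - (shift₂ hz).1
    · exact d10 _ hz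
    · change pd 2 (f 2 0) z = 0
      linear_combination (base hz).2.2 - (shift₂ hz).2.2
  · fin_cases i
    · change pd 2 (f 0 1) z = 0
      linear_combination (shift₃ hz).1 - (base hz).1
    · change pd 2 (f 1 1) z = 0
      linear_combination (shift₃ hz).2.1 - (base hz).2.1
    · change pd 2 (f 2 1) z = 0
      linear_combination (shift₃ hz).2.2 - (base hz).2.2
  · linear_combination (base hz).1
  · linear_combination (base hz).2.1
  · linear_combination (base hz).2.2
  -- If f₁₁' = f₃₁' = 0, u_t drops out of the structure equations, which would then also hold with
  -- u_t = F + 1.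
  · by_contra! h0
    have h := (key hz ![F z + 1, 0, 0] 0).1 (by
      simp only [Matrix.cons_val_zero, Matrix.cons_val_one, Matrix.cons_val, h0.1, h0.2, zero_mul,
        mul_zero, add_zero]
      simpa [h0.1, h0.2] using base hz)
    simp at h

/-- The exceptional equations describe `η` pseudo-spherical surfaces. -/
theorem IsExceptional.describesPSS (hη : η ≠ 0) (hU : IsOpen U)
    (hf : ∀ i j, ContDiffOn ℝ ∞ (f i j) U) (H : IsExceptional η U f F) :
    DescribesPSS η U f F := by
  obtain ⟨ε, lam, hε, h⟩ := H
  have hε2 : ε * ε = 1 := by rcases hε with rfl | rfl <;> norm_num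
  refine ⟨fun z hz => (h z hz).1, ?_, ?_⟩
  · intro z hz
    rw [mem_closure_iff]
    intro V hV hzV
    have hVU : IsOpen (V ∩ U) := hV.inter hU
    by_contra hne
    have h0 : ∀ w ∈ V ∩ U, η * f 0 1 w = lam * f 0 0 w := by
      intro w hw
      by_contra h1
      refine hne ⟨w, hw.1, hw.2, fun h2 => h1 ?_⟩
      rw [area, wedge, (h w hw.2).1, (h w hw.2).2.1] at h2
      linarith
    -- On an open set with ω¹ ∧ ω² = 0 one has ηf₁₂ = λf₁₁. The right side is independent of z₁, but
    -- f₁₂,₁ ≠ 0.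
    have e := deriv_eq_of_line (k := 1) hVU ⟨hzV, hz⟩
      ((hasDerivAt_line hU (hf 0 1) hz 1).const_mul η)
      ((hasDerivAt_line hU (hf 0 0) hz 1).const_mul lam) (fun s hs => h0 _ hs)
    obtain ⟨-, -, -, -, h1, -, -, -, h2, -⟩ := h z hz
    rw [h1, mul_zero] at e
    exact mul_ne_zero hη h2 e
  · intro u hu x t hz
    obtain ⟨τ, hτ, hτ0⟩ := exists_hasDerivAt_spaceJet_t hu x t
    have hσ := hasDerivAt_spaceJet_x hu x t
    rw [structureAt_iff hU hf hz hσ hτ rfl, ← hτ0]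
    have z1 : iteratedDeriv (((0 : Fin 3) : ℕ) + 1) (fun y => u y t) x = spaceJet u x t 1 := rfl
    have z2 : iteratedDeriv (((1 : Fin 3) : ℕ) + 1) (fun y => u y t) x = spaceJet u x t 2 := rfl
    simp only [fderiv_apply_eq_sum, z1, z2]
    set z := spaceJet u x t
    have e10 (k) : pd k (f 1 0) z = 0 :=
      pd_eq_zero_of_eqOn_const hU (fun w hw => (h w hw).1) hz k
    have e11 (k) : pd k (f 1 1) z = 0 :=
      pd_eq_zero_of_eqOn_const hU (fun w hw => (h w hw).2.1) hz k
    have hscale (j : Fin 2) (hj : ∀ w ∈ U, f 2 j w = ε * f 0 j w) (k) :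
        pd k (f 2 j) z = ε * pd k (f 0 j) z :=
      deriv_eq_of_line hU hz (hasDerivAt_line hU (hf 2 j) hz k)
        ((hasDerivAt_line hU (hf 0 j) hz k).const_mul ε) (fun s hs => hj _ hs)
    have e20 := hscale 0 (fun w hw => (h w hw).2.2.1)
    have e21 := hscale 1 (fun w hw => (h w hw).2.2.2.1)
    obtain ⟨h10, h11, h20, h21, p1, p2, q2, p0, q1, hFz⟩ := h z hz
    simp only [e10, e11, e20, e21, h10, h11, h20, h21, p1, p2, q2, mul_zero, add_zero, sub_zero]
    have hF' : pd 0 (f 0 0) z * F z = pd 1 (f 0 1) z * z 2 + pd 0 (f 0 1) z * z 1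
        - ε * (lam * f 0 0 z - η * f 0 1 z) := by
      rw [hFz]
      field_simp
    constructor
    · rintro ⟨h1, -, -⟩
      exact mul_left_cancel₀ p0 (by linear_combination -h1 - hF')
    · intro h1
      rw [h1]
      -- Since ω³ = εω¹ and ω² has constant coefficients, the second equation is trivial and the
      -- third is ε times the first, by ε² = 1.
      refine ⟨by linear_combination -hF', by ring, ?_⟩
      linear_combination (-ε) * hF' + (lam * f 0 0 z - η * f 0 1 z) * hε2

end

/-! ### The Codazzi equations without jet derivatives, and the vanishing of L. -/

section

variable {η : ℝ} {U : Set (Fin 3 → ℝ)} {f : Coeffs} {F : (Fin 3 → ℝ) → ℝ}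
  {m : ℕ} {W : Set (JetSpace m)} {a b c : JetSpace m → ℝ}

lemma fderiv_jet_eq {a : JetSpace m → ℝ} {q : JetSpace m}
    (h : ∀ k, fderiv ℝ a q (vert m k) = 0) (v : JetSpace m) :
    fderiv ℝ a q v
      = v.1 * fderiv ℝ a q (1, 0, 0) + v.2.1 * fderiv ℝ a q (0, 1, 0) := by
  obtain ⟨Z, hZ⟩ := exists_jetPoint_eq v
  have h0 := jet_eq_sum (m := m) Z
  have hv : v = v.1 • ((1, 0, 0) : JetSpace m) + v.2.1 • ((0, 1, 0) : JetSpace m)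
      + ∑ i ∈ Finset.range (3 + m), Z i • vert m i := by
    have h1 : ∑ i ∈ Finset.range (3 + m), Z i • vert m i
        = ((0, 1, res (3 + m) Z) : JetSpace m) - (0, 1, 0) := by
      rw [eq_sub_iff_add_eq', ← h0]
      rfl
    rw [h1]
    conv_lhs => rw [hZ]
    simp [jetPoint]
  conv_lhs => rw [hv]
  simp only [map_add, map_sum, map_smul, h, smul_eq_mul, mul_zero,
    Finset.sum_const_zero, add_zero]

lemma Dx_eq {a : JetSpace m → ℝ} {x t : ℝ} {Z : ℕ → ℝ}
    (h : ∀ k, fderiv ℝ a (jetPoint m x t Z) (vert m k) = 0) :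
    Dx a x t Z = fderiv ℝ a (jetPoint m x t Z) (1, 0, 0) := by
  rw [Dx]
  exact (fderiv_jet_eq h _).trans (by simp)

lemma Dt_eq {a : JetSpace m → ℝ} {x t : ℝ} {Z : ℕ → ℝ}
    (h : ∀ k, fderiv ℝ a (jetPoint m x t Z) (vert m k) = 0) :
    Dt F a x t Z = fderiv ℝ a (jetPoint m x t Z) (0, 1, 0) := by
  rw [Dt]
  exact (fderiv_jet_eq h _).trans (by simp)

/-- The Wronskian of `f₁₁` and `f₃₁`. -/
def wronskian (f : Coeffs) (z : Fin 3 → ℝ) : ℝ :=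
  f 0 0 z * pd 0 (f 2 0) z - f 2 0 z * pd 0 (f 0 0) z

namespace IsSecondFundamentalForm

lemma codazzi₁_reduced (S : StructureIdentities η U f F) (hη : η ≠ 0)
    (H : IsSecondFundamentalForm U f F W a b c) {q : JetSpace m} (hq : q ∈ W) :
    f 0 1 (base q) * fderiv ℝ a q (1, 0, 0) - f 0 0 (base q) * fderiv ℝ a q (0, 1, 0)
      + f 1 1 (base q) * fderiv ℝ b q (1, 0, 0) - η * fderiv ℝ b q (0, 1, 0)
      + 2 * b q * (f 0 0 (base q) * f 2 1 (base q) - f 0 1 (base q) * f 2 0 (base q))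
      + (a q - c q) * (f 2 0 (base q) * f 1 1 (base q) - f 2 1 (base q) * η) = 0 := by
  obtain ⟨Z, hZ⟩ := exists_jetPoint_eq q
  generalize q.1 = x at hZ
  generalize q.2.1 = t at hZ
  subst hZ
  have hv := fun k => H.vert_eq_zero S hη hq k
  have h := H.codazzi₁_expanded S hq
  rwa [Dx_eq (fun k => (hv k).1), Dx_eq (fun k => (hv k).2.1), Dt_eq (fun k => (hv k).1),
    Dt_eq (fun k => (hv k).2.1)] at h

lemma codazzi₂_reduced (S : StructureIdentities η U f F) (hη : η ≠ 0)
    (H : IsSecondFundamentalForm U f F W a b c) {q : JetSpace m} (hq : q ∈ W) :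
    f 0 1 (base q) * fderiv ℝ b q (1, 0, 0) - f 0 0 (base q) * fderiv ℝ b q (0, 1, 0)
      + f 1 1 (base q) * fderiv ℝ c q (1, 0, 0) - η * fderiv ℝ c q (0, 1, 0)
      + 2 * b q * (f 2 0 (base q) * f 1 1 (base q) - f 2 1 (base q) * η)
      + (c q - a q) * (f 0 0 (base q) * f 2 1 (base q) - f 0 1 (base q) * f 2 0 (base q)) = 0 := by
  obtain ⟨Z, hZ⟩ := exists_jetPoint_eq q
  generalize q.1 = x at hZ
  generalize q.2.1 = t at hZ
  subst hZ
  have hv := fun k => H.vert_eq_zero S hη hq k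
  have h := H.codazzi₂_expanded S hq
  rwa [Dx_eq (fun k => (hv k).2.1), Dx_eq (fun k => (hv k).2.2), Dt_eq (fun k => (hv k).2.1),
    Dt_eq (fun k => (hv k).2.2)] at h

end IsSecondFundamentalForm

lemma hasDerivAt_line_const {g : JetSpace m → ℝ} (hW : IsOpen W) (hg : ContDiffOn ℝ ∞ g W)
    (hv : ∀ q ∈ W, ∀ k, fderiv ℝ g q (vert m k) = 0) {q : JetSpace m} (hq : q ∈ W) (k : ℕ) :
    HasDerivAt (fun s : ℝ => g (q + s • vert m k)) 0 0 := by
  simpa [hv q hq k] using hasDerivAt_comp_add_smul hW hg hq (vert m k)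

lemma hasDerivAt_line_fderiv_const {g : JetSpace m → ℝ} (hW : IsOpen W)
    (hg : ContDiffOn ℝ ∞ g W) (hv : ∀ q ∈ W, ∀ k, fderiv ℝ g q (vert m k) = 0) {q : JetSpace m}
    (hq : q ∈ W) (k : ℕ) (w : JetSpace m) :
    HasDerivAt (fun s : ℝ => fderiv ℝ g (q + s • vert m k) w) 0 0 := by
  have h := hasDerivAt_comp_add_smul hW (contDiffOn_fderiv_apply hW hg w) hq (vert m k)
  rwa [fderiv_fderiv_eq_zero hW hg (fun p hp => hv p hp k) hq] at h

lemma base_add_smul_vert (q : JetSpace m) (k : Fin 3) (s : ℝ) :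
    base (q + s • vert m k) = line k (base q) s := by
  have h : base (vert m k) = (Pi.single k 1 : Fin 3 → ℝ) := by
    have := res_single_of_lt k
    rw [← this]
    rfl
  rw [line, ← h, ← baseL_apply, ← baseL_apply, ← baseL_apply, map_add, map_smul]

lemma deriv_eq_of_vertLine {O : Set (JetSpace m)} (hO : IsOpen O) {q : JetSpace m} (hq : q ∈ O)
    (k : ℕ) {φ ψ : ℝ → ℝ} {d e : ℝ} (hφ : HasDerivAt φ d 0) (hψ : HasDerivAt ψ e 0)
    (he : ∀ s : ℝ, q + s • vert m k ∈ O → φ s = ψ s) : d = e := by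
  have hc : Continuous fun s : ℝ => q + s • vert m k := by fun_prop
  have hm : ∀ᶠ s in 𝓝 (0 : ℝ), q + s • vert m k ∈ O :=
    hc.continuousAt.eventually_mem (by simpa using hO.mem_nhds hq)
  exact hφ.unique (hψ.congr_of_eventuallyEq (hm.mono he))

variable {q : JetSpace m}

lemma hasDerivAt_base (S : StructureIdentities η U f F) (hz : base q ∈ U) (i : Fin 3) (j : Fin 2)
    (k : Fin 3) : HasDerivAt (fun s : ℝ => f i j (base (q + s • vert m k)))
      (pd k (f i j) (base q)) 0 := by
  simp only [base_add_smul_vert]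
  exact S.line_f i j k hz

namespace IsSecondFundamentalForm

/-- The `z₁`-derivatives of the Codazzi equations. -/
lemma codazzi_pd1 (S : StructureIdentities η U f F) (hη : η ≠ 0)
    (H : IsSecondFundamentalForm U f F W a b c) (hq : q ∈ W) :
    pd 0 (f 0 0) (base q) * fderiv ℝ a q (1, 0, 0) + 2 * b q * wronskian f (base q)
      - η * (a q - c q) * pd 0 (f 2 0) (base q) = 0 ∧
    pd 0 (f 0 0) (base q) * fderiv ℝ b q (1, 0, 0) - 2 * b q * η * pd 0 (f 2 0) (base q)
      + (c q - a q) * wronskian f (base q) = 0 := by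
  have hz := H.base_mem q hq
  have hv := fun q hq k => H.vert_eq_zero S hη (q := q) hq k
  have B (i j) := hasDerivAt_base S hz i j 1
  have fa := hasDerivAt_line_const H.isOpen H.smooth_a (fun q hq k => (hv q hq k).1) hq (1 : Fin 3)
  have fb := hasDerivAt_line_const H.isOpen H.smooth_b (fun q hq k => (hv q hq k).2.1) hq
    (1 : Fin 3)
  have fc := hasDerivAt_line_const H.isOpen H.smooth_c (fun q hq k => (hv q hq k).2.2) hq
    (1 : Fin 3)
  have ga := hasDerivAt_line_fderiv_const H.isOpen H.smooth_a (fun q hq k => (hv q hq k).1) hq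
    (1 : Fin 3)
  have gb := hasDerivAt_line_fderiv_const H.isOpen H.smooth_b (fun q hq k => (hv q hq k).2.1) hq
    (1 : Fin 3)
  have gc := hasDerivAt_line_fderiv_const H.isOpen H.smooth_c (fun q hq k => (hv q hq k).2.2) hq
    (1 : Fin 3)
  have e1 := deriv_eq_of_vertLine H.isOpen hq _
    (((((((B 0 1).fun_mul (ga _)).fun_sub ((B 0 0).fun_mul (ga _))).fun_add
      ((B 1 1).fun_mul (gb _))).fun_sub ((gb _).const_mul η)).fun_add
      ((fb.const_mul 2).fun_mul
        (((B 0 0).fun_mul (B 2 1)).fun_sub ((B 0 1).fun_mul (B 2 0))))).fun_add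
      ((fa.fun_sub fc).fun_mul (((B 2 0).fun_mul (B 1 1)).fun_sub ((B 2 1).mul_const η))))
    (hasDerivAt_const (0 : ℝ) (0 : ℝ)) (fun s hs => H.codazzi₁_reduced S hη hs)
  have e2 := deriv_eq_of_vertLine H.isOpen hq _
    (((((((B 0 1).fun_mul (gb _)).fun_sub ((B 0 0).fun_mul (gb _))).fun_add
      ((B 1 1).fun_mul (gc _))).fun_sub ((gc _).const_mul η)).fun_add
      ((fb.const_mul 2).fun_mul (((B 2 0).fun_mul (B 1 1)).fun_sub ((B 2 1).mul_const η)))).fun_add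
      ((fc.fun_sub fa).fun_mul (((B 0 0).fun_mul (B 2 1)).fun_sub ((B 0 1).fun_mul (B 2 0)))))
    (hasDerivAt_const (0 : ℝ) (0 : ℝ)) (fun s hs => H.codazzi₂_reduced S hη hs)
  have hG := S.pd_F_ne _ hz
  simp only [zero_smul, add_zero, S.pd1_dx _ _ hz, S.pd1_f12 hz, S.pd1_f22 hz, S.pd1_f32 hz]
    at e1 e2
  rw [wronskian]
  exact ⟨mul_left_cancel₀ hG (by linear_combination e1),
    mul_left_cancel₀ hG (by linear_combination e2)⟩

lemma gauss_fderiv (H : IsSecondFundamentalForm U f F W a b c) (hq : q ∈ W) (v : JetSpace m) :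
    fderiv ℝ a q v * c q + a q * fderiv ℝ c q v = 2 * b q * fderiv ℝ b q v := by
  have hg := fderiv_eq_zero_of_eqOn_const H.isOpen (g := fun q => a q * c q - b q * b q)
    (fun p hp => (by rw [← sq]; exact H.gauss p hp)) hq
  have da := (differentiableAt_of_smooth H.isOpen H.smooth_a hq).hasFDerivAt
  have db := (differentiableAt_of_smooth H.isOpen H.smooth_b hq).hasFDerivAt
  have dc := (differentiableAt_of_smooth H.isOpen H.smooth_c hq).hasFDerivAt
  rw [((da.fun_mul dc).fun_sub (db.fun_mul db)).fderiv] at hg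
  have hg' := congrArg (fun L : JetSpace m →L[ℝ] ℝ => L v) hg
  simp only [sub_apply, add_apply, smul_apply, smul_eq_mul, zero_apply] at hg'
  linear_combination hg'

lemma not_umbilic (H : IsSecondFundamentalForm U f F W a b c) (hq : q ∈ W) (hac : a q - c q = 0)
    (hb : b q = 0) : False := by
  have h := H.gauss q hq
  rw [hb, ← sub_eq_zero.1 hac] at h
  nlinarith [sq_nonneg (a q)]

/-- If f₁₁' = 0 then f₃₁' ≠ 0, and the z₁-derivatives of the Codazzi equations are a linear system
for (2b, a − c) with determinant η² + f₁₁² > 0. The point would be umbilic. -/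
lemma pd0_f11_ne (S : StructureIdentities η U f F) (hη : η ≠ 0)
    (H : IsSecondFundamentalForm U f F W a b c) (hq : q ∈ W) : pd 0 (f 0 0) (base q) ≠ 0 := by
  intro h0
  have hz := H.base_mem q hq
  have h3 : pd 0 (f 2 0) (base q) ≠ 0 := (S.nondeg _ hz).resolve_left (not_not.2 h0)
  obtain ⟨A1, A2⟩ := H.codazzi_pd1 S hη hq
  rw [wronskian, h0] at A1 A2
  have B1 : 2 * b q * f 0 0 (base q) - η * (a q - c q) = 0 :=
    mul_left_cancel₀ h3 (by linear_combination A1)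
  have B2 : 2 * b q * η + (a q - c q) * f 0 0 (base q) = 0 :=
    mul_left_cancel₀ h3 (by linear_combination -A2)
  have hpos : η ^ 2 + f 0 0 (base q) ^ 2 ≠ 0 := by positivity
  have hac : a q - c q = 0 := mul_left_cancel₀ hpos (by
    linear_combination f 0 0 (base q) * B2 - η * B1)
  rw [hac] at B2
  exact H.not_umbilic hq hac (by simpa [hη] using B2)

end IsSecondFundamentalForm

namespace StructureIdentities

variable {z : Fin 3 → ℝ}

/-- Let R = f₁₁f₁₁' − f₃₁f₃₁', half the z₀-derivative of f₁₁² − f₃₁². If R ≡ 0, then R' = 0 and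
f₁₁'f₃₁'' = f₃₁'f₁₁'' give f₁₁'² = f₃₁'², and R = 0 then implies L = 0. -/
lemma exists_ne_zero_of_wronskian_ne (S : StructureIdentities η U f F) {V : Set (Fin 3 → ℝ)}
    (hV : IsOpen V) (hVU : V ⊆ U) (hz : z ∈ V) (hL : wronskian f z ≠ 0)
    (h0 : pd 0 (f 0 0) z ≠ 0) :
    ∃ w ∈ V, f 0 0 w * pd 0 (f 0 0) w - f 2 0 w * pd 0 (f 2 0) w ≠ 0 := by
  by_contra! hR
  have hzU := hVU hz
  have e := deriv_eq_of_line (k := 0) hV hz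
    (((S.line_f 0 0 0 hzU).fun_mul (S.line_pd 0 0 0 0 hzU)).fun_sub
      ((S.line_f 2 0 0 hzU).fun_mul (S.line_pd 2 0 0 0 hzU)))
    (hasDerivAt_const (0 : ℝ) (0 : ℝ)) (fun s hs => hR _ hs)
  simp only [line_zero] at e
  have hW := S.wronskian_eq_zero hzU
  have hR0 := hR z hz
  have h1 : pd 0 (f 0 0) z ^ 2 - pd 0 (f 2 0) z ^ 2 = 0 := by
    refine mul_left_cancel₀ h0 ?_
    linear_combination pd 0 (f 0 0) z * e + f 2 0 z * hW - pd 0 (pd 0 (f 0 0)) z * hR0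
  refine hL (mul_left_cancel₀ h0 ?_)
  rw [wronskian]
  linear_combination pd 0 (f 2 0) z * hR0 - f 2 0 z * h1

/-- Put p = f₁₂ − z₁Gf₁₁', r = f₃₂ − z₁Gf₃₁', X = f₁₁f₂₂ − ηp, Y = f₃₁f₂₂ − ηr. Subtracting z₁ times
`compat_pd1` from `compat` gives f₁₁'X = f₃₁'Y, while f₁₁r = f₃₁p gives f₃₁X = f₁₁Y. The determinant
of this system is, up to sign, the quantity in `hR`. -/
lemma relations_of_ne (S : StructureIdentities η U f F) (hz : z ∈ U)
    (hR : f 0 0 z * pd 0 (f 0 0) z - f 2 0 z * pd 0 (f 2 0) z ≠ 0) :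
    f 0 0 z * f 1 1 z = η * (f 0 1 z - z 1 * pd 2 F z * pd 0 (f 0 0) z) ∧
    f 2 0 z * f 1 1 z = η * (f 2 1 z - z 1 * pd 2 F z * pd 0 (f 2 0) z) ∧
    f 0 0 z * (f 2 1 z - z 1 * pd 2 F z * pd 0 (f 2 0) z)
      = f 2 0 z * (f 0 1 z - z 1 * pd 2 F z * pd 0 (f 0 0) z) := by
  have h1 := S.compat hz
  have h2 := S.compat_pd1 hz
  have hW := S.wronskian_eq_zero hz
  have h3 := S.pd0_f22_mul hz
  rw [S.pd0_f22 hz] at h3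
  have hpq : f 0 0 z * (f 2 1 z - z 1 * pd 2 F z * pd 0 (f 2 0) z)
      = f 2 0 z * (f 0 1 z - z 1 * pd 2 F z * pd 0 (f 0 0) z) := by
    linear_combination -h3
  have key : pd 0 (f 2 0) z * (f 2 0 z * f 1 1 z
        - η * (f 2 1 z - z 1 * pd 2 F z * pd 0 (f 2 0) z))
      = pd 0 (f 0 0) z * (f 0 0 z * f 1 1 z
        - η * (f 0 1 z - z 1 * pd 2 F z * pd 0 (f 0 0) z)) := by
    linear_combination z 1 * h2 - h1 + z 1 ^ 2 * pd 2 F z * hW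
  refine ⟨mul_left_cancel₀ hR ?_, mul_left_cancel₀ hR ?_, hpq⟩
  · linear_combination -f 0 0 z * key - η * pd 0 (f 2 0) z * hpq
  · linear_combination -f 2 0 z * key - η * pd 0 (f 0 0) z * hpq

end StructureIdentities

namespace IsSecondFundamentalForm

variable {q : JetSpace m}

lemma wronskian_eq_zero (S : StructureIdentities η U f F) (hη : η ≠ 0)
    (H : IsSecondFundamentalForm U f F W a b c) (hq : q ∈ W) : wronskian f (base q) = 0 := by
  by_contra hne
  have sm (i : Fin 3) : ContDiffOn ℝ ∞ (pd 0 (f i 0)) U := contDiffOn_pd S.isOpen (S.smooth i 0) 0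
  have hWc : ContinuousOn (wronskian f) U :=
    (((S.smooth 0 0).mul (sm 2)).sub ((S.smooth 2 0).mul (sm 0))).continuousOn
  have hRc : ContinuousOn (fun z => f 0 0 z * pd 0 (f 0 0) z - f 2 0 z * pd 0 (f 2 0) z) U :=
    (((S.smooth 0 0).mul (sm 0)).sub ((S.smooth 2 0).mul (sm 2))).continuousOn
  set V := U ∩ {z | wronskian f z ≠ 0}
  have hVo : IsOpen V := hWc.isOpen_inter_preimage S.isOpen isOpen_ne
  set V' := U ∩ {z | f 0 0 z * pd 0 (f 0 0) z - f 2 0 z * pd 0 (f 2 0) z ≠ 0}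
  have hVo' : IsOpen V' := hRc.isOpen_inter_preimage S.isOpen isOpen_ne
  set O := W ∩ base ⁻¹' V ∩ base ⁻¹' V'
  have hO : IsOpen O :=
    (H.isOpen.inter (hVo.preimage continuous_base)).inter (hVo'.preimage continuous_base)
  obtain ⟨w, ⟨⟨p, hp, rfl⟩, hpV⟩, hpR⟩ := S.exists_ne_zero_of_wronskian_ne
    (V := base '' W ∩ V) ((isOpenMap_base W H.isOpen).inter hVo) (fun _ h => h.2.1)
    ⟨⟨q, hq, rfl⟩, H.base_mem q hq, hne⟩ hne (H.pd0_f11_ne S hη hq)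
  have hpO : p ∈ O := ⟨⟨hp, hpV⟩, hpV.1, hpR⟩
  have hv := fun q hq k => H.vert_eq_zero S hη (q := q) hq k
  have va := fun q hq k => (hv q hq k).1
  have vb := fun q hq k => (hv q hq k).2.1
  have vc := fun q hq k => (hv q hq k).2.2
  -- Subtract z₁G times the z₁-derivatives from the Codazzi equations. By `relations_of_ne` the
  -- undifferentiated terms cancel, leaving the pattern of `vert_relations` with the vector field
  -- f₂₂∂_x − η∂_t in place of ∂/∂z_k.
  have rel {q : JetSpace m} (hq : q ∈ O) :
      f 0 0 (base q) * (f 1 1 (base q) * fderiv ℝ a q (1, 0, 0) - η * fderiv ℝ a q (0, 1, 0))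
        + η * (f 1 1 (base q) * fderiv ℝ b q (1, 0, 0) - η * fderiv ℝ b q (0, 1, 0)) = 0 ∧
      f 0 0 (base q) * (f 1 1 (base q) * fderiv ℝ b q (1, 0, 0) - η * fderiv ℝ b q (0, 1, 0))
        + η * (f 1 1 (base q) * fderiv ℝ c q (1, 0, 0) - η * fderiv ℝ c q (0, 1, 0)) = 0 := by
    have hqW := hq.1.1
    have hz := H.base_mem q hqW
    have E1 := H.codazzi₁_reduced S hη hqW
    have E2 := H.codazzi₂_reduced S hη hqW
    obtain ⟨A1, A2⟩ := H.codazzi_pd1 S hη hqW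
    obtain ⟨r1, r2, r3⟩ := S.relations_of_ne hz hq.2.2
    rw [wronskian] at A1 A2
    constructor
    · linear_combination η * (E1 - base q 1 * pd 2 F (base q) * A1)
        + fderiv ℝ a q (1, 0, 0) * r1 - 2 * η * b q * r3 - η * (a q - c q) * r2
    · linear_combination η * (E2 - base q 1 * pd 2 F (base q) * A2)
        + fderiv ℝ b q (1, 0, 0) * r1 - 2 * η * b q * r2 - η * (c q - a q) * r3
  -- As before, a nonzero derivative of a would make the second fundamental form vanish on ∂_x. Now
  -- a, b, c have no z₀-derivative while f₁₁' ≠ 0, so differentiating `hT` in z₀ yields af₁₁ + bη =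
  -- 0, then bf₁₁ + cη = 0, hence ac − b² = 0.
  have hα {q : JetSpace m} (hq : q ∈ O) :
      f 1 1 (base q) * fderiv ℝ a q (1, 0, 0) - η * fderiv ℝ a q (0, 1, 0) = 0 := by
    by_contra hne
    have hαc : ContinuousOn (fun q : JetSpace m =>
        f 1 1 (base q) * fderiv ℝ a q (1, 0, 0) - η * fderiv ℝ a q (0, 1, 0)) W := by
      refine (ContinuousOn.mul ((S.smooth 1 1).continuousOn.comp continuous_base.continuousOn
        H.base_mem) ?_).sub (continuousOn_const.mul ?_)
      · exact (contDiffOn_fderiv_apply H.isOpen H.smooth_a _).continuousOn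
      · exact (contDiffOn_fderiv_apply H.isOpen H.smooth_a _).continuousOn
    set O' := O ∩ (W ∩ {q | f 1 1 (base q) * fderiv ℝ a q (1, 0, 0)
      - η * fderiv ℝ a q (0, 1, 0) ≠ 0})
    have hO' : IsOpen O' := hO.inter (hαc.isOpen_inter_preimage H.isOpen isOpen_ne)
    have hT : ∀ q ∈ O',
        c q * η ^ 2 + a q * f 0 0 (base q) ^ 2 + 2 * b q * η * f 0 0 (base q) = 0 := by
      intro q hq
      obtain ⟨r1, r2⟩ := rel hq.1
      have g1 := H.gauss_fderiv hq.2.1 (1, 0, 0)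
      have g2 := H.gauss_fderiv hq.2.1 (0, 1, 0)
      refine mul_left_cancel₀ hq.2.2 ?_
      linear_combination η ^ 2 * (f 1 1 (base q) * g1 - η * g2)
        + (2 * η * b q + a q * f 0 0 (base q)) * r1 - a q * η * r2
    have hqO' : q ∈ O' := ⟨hq, hq.1.1, hne⟩
    have hqW := hq.1.1
    have hz := H.base_mem q hqW
    have B (i j) := hasDerivAt_base S hz i j 0
    have fa := hasDerivAt_line_const H.isOpen H.smooth_a va hqW (0 : Fin 3)
    have fb := hasDerivAt_line_const H.isOpen H.smooth_b vb hqW (0 : Fin 3)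
    have fc := hasDerivAt_line_const H.isOpen H.smooth_c vc hqW (0 : Fin 3)
    have e := deriv_eq_of_vertLine hO' hqO' _
      (((fc.mul_const (η ^ 2)).fun_add (fa.fun_mul ((B 0 0).fun_pow 2))).fun_add
        (((fb.const_mul 2).mul_const η).fun_mul (B 0 0)))
      (hasDerivAt_const (0 : ℝ) (0 : ℝ)) (fun s hs => hT _ hs)
    simp only [zero_smul, add_zero] at e
    have h1 : a q * f 0 0 (base q) + b q * η = 0 := by
      refine mul_left_cancel₀ (H.pd0_f11_ne S hη hqW) ?_
      linear_combination e / 2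
    have h2 : c q * η + b q * f 0 0 (base q) = 0 := by
      refine mul_left_cancel₀ hη ?_
      linear_combination hT q hqO' - f 0 0 (base q) * h1
    have h3 := H.gauss q hqW
    exact hη (by linear_combination η * h3 - a q * h2 + b q * h1)
  have hpW := hp
  have hz := H.base_mem p hpW
  have hf22 : pd 0 (f 1 1) (base p) ≠ 0 := by
    rw [S.pd0_f22 hz]
    exact mul_ne_zero (S.pd_F_ne _ hz) hpV.2
  have B (i j) := hasDerivAt_base S hz i j 0
  have ga := hasDerivAt_line_fderiv_const H.isOpen H.smooth_a va hpW (0 : Fin 3)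
  have gb := hasDerivAt_line_fderiv_const H.isOpen H.smooth_b vb hpW (0 : Fin 3)
  -- In f₂₂a_x = ηa_t only f₂₂ varies with z₀, and f₂₂' = G·L ≠ 0; hence a_x = 0, and b_x = 0
  -- likewise.
  have ea := deriv_eq_of_vertLine hO hpO _
    (((B 1 1).fun_mul (ga (1, 0, 0))).fun_sub ((ga (0, 1, 0)).const_mul η))
    (hasDerivAt_const (0 : ℝ) (0 : ℝ)) (fun s hs => hα hs)
  have eb := deriv_eq_of_vertLine hO hpO _
    (((B 1 1).fun_mul (gb (1, 0, 0))).fun_sub ((gb (0, 1, 0)).const_mul η))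
    (hasDerivAt_const (0 : ℝ) (0 : ℝ)) (fun s hs => by
      have h := (rel hs).1
      rw [hα hs] at h
      exact mul_left_cancel₀ hη (by linear_combination h))
  have ax : fderiv ℝ a p (1, 0, 0) = 0 := by simpa [hf22] using ea
  have bx : fderiv ℝ b p (1, 0, 0) = 0 := by simpa [hf22] using eb
  obtain ⟨A1, A2⟩ := H.codazzi_pd1 S hη hpW
  rw [ax] at A1
  rw [bx] at A2
  have hL : wronskian f (base p) ≠ 0 := hpV.2
  -- Up to sign, the determinant of the system for (2b, a − c) that remains once a_x = b_x = 0.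
  have hpos : (η * pd 0 (f 2 0) (base p)) ^ 2 + wronskian f (base p) ^ 2 ≠ 0 := by positivity
  have hac : a p - c p = 0 := mul_left_cancel₀ hpos (by
    linear_combination -wronskian f (base p) * A2 - η * pd 0 (f 2 0) (base p) * A1)
  rw [hac] at A1
  exact H.not_umbilic hpW hac (by simpa [hL] using A1)

/-- There is a `2`-jet at which `f₃₁ = ± f₁₁` to first order. -/
lemma exists_sign (S : StructureIdentities η U f F) (hη : η ≠ 0)
    (H : IsSecondFundamentalForm U f F W a b c) :
    ∃ z ∈ U, ∃ ε : ℝ, (ε = 1 ∨ ε = -1) ∧ f 2 0 z = ε * f 0 0 z ∧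
      pd 0 (f 2 0) z = ε * pd 0 (f 0 0) z := by
  set V := base '' W with hVdef
  have hV : IsOpen V := isOpenMap_base W H.isOpen
  have hVU : V ⊆ U := by rintro _ ⟨p, hp, rfl⟩; exact H.base_mem p hp
  have hL : ∀ z ∈ V, wronskian f z = 0 := by
    rintro _ ⟨p, hp, rfl⟩; exact H.wronskian_eq_zero S hη hp
  have hp0 : ∀ z ∈ V, pd 0 (f 0 0) z ≠ 0 := by
    rintro _ ⟨p, hp, rfl⟩; exact H.pd0_f11_ne S hη hp
  obtain ⟨q, hq⟩ := H.isConnected.nonempty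
  obtain ⟨z₁, hz₁, hne₁⟩ := exists_ne_zero_of_pd_ne_zero hV ⟨q, hq, rfl⟩ 0
    (hp0 _ ⟨q, hq, rfl⟩)
  have hV' : IsOpen (V ∩ {z | f 0 0 z ≠ 0}) :=
    ((S.smooth 0 0).continuousOn.mono hVU).isOpen_inter_preimage hV isOpen_ne
  obtain ⟨z, ⟨hz, hne⟩, harea⟩ := S.exists_area_ne_zero hV' (fun _ h => hVU h.1) ⟨hz₁, hne₁⟩
  have hne : f 0 0 z ≠ 0 := hne
  have hzU := hVU hz
  -- L = 0 gives f₂₂' = 0, so ω¹ ∧ ω³ = 0.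
  have hF {w} (hw : w ∈ V) : f 0 0 w * f 2 1 w - f 0 1 w * f 2 0 w = 0 := by
    rw [← S.pd0_f22_mul (hVU hw), S.pd0_f22 (hVU hw)]
    have := hL w hw
    rw [wronskian] at this
    rw [this]
    ring
  have e := deriv_eq_of_line (k := 0) hV hz
    (((S.line_f 0 0 0 hzU).fun_mul (S.line_f 2 1 0 hzU)).fun_sub
      ((S.line_f 0 1 0 hzU).fun_mul (S.line_f 2 0 0 hzU)))
    (hasDerivAt_const (0 : ℝ) (0 : ℝ)) (fun s hs => hF hs)
  simp only [line_zero] at e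
  have hLz := hL z hz
  rw [wronskian] at hLz
  have hFz := hF hz
  have hp := hp0 z hz
  have hK := S.compat hzU
  obtain ⟨k, hk⟩ : ∃ k, f 2 0 z = k * f 0 0 z := ⟨f 2 0 z / f 0 0 z, by field_simp⟩
  have hk' : pd 0 (f 2 0) z = k * pd 0 (f 0 0) z :=
    mul_left_cancel₀ hne (by rw [hk] at hLz; linear_combination hLz)
  have h32 : f 2 1 z = k * f 0 1 z :=
    mul_left_cancel₀ hne (by rw [hk] at hFz; linear_combination hFz)
  have h32' : pd 0 (f 2 1) z = k * pd 0 (f 0 1) z := by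
    rw [hk, hk', h32] at e
    exact mul_left_cancel₀ hne (by linear_combination e)
  have ha : f 0 0 z * f 1 1 z - f 0 1 z * η ≠ 0 := by
    rwa [area, wedge, S.f21 z hzU] at harea
  rw [hk, hk', h32, h32'] at hK
  -- With f₃ⱼ = k f₁ⱼ and the same for z₀-derivatives, `compat` reduces to (1 − k²)·f₁₁'·(ω¹ ∧ ω²) =
  -- 0.
  have hk2 : (k - 1) * (k + 1) = 0 := by
    refine mul_left_cancel₀ (mul_ne_zero hp ha) ?_
    linear_combination -hK
  refine ⟨z, hzU, k, ?_, hk, hk'⟩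
  rcases mul_eq_zero.1 hk2 with h | h
  · exact Or.inl (by linarith)
  · exact Or.inr (by linarith)

end IsSecondFundamentalForm

end

/-! ### The exceptional equations: necessity, universality and existence. -/

section

variable {η : ℝ} {U : Set (Fin 3 → ℝ)} {f : Coeffs} {F : (Fin 3 → ℝ) → ℝ}
  {m : ℕ} {W : Set (JetSpace m)} {a b c : JetSpace m → ℝ}

/-- If `f₃₁ = ε f₁₁` to first order at one point of a connected `U`, then on all of `U`. -/
lemma StructureIdentities.f31_eq (S : StructureIdentities η U f F) (hUc : IsConnected U) {ε : ℝ}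
    {z₀ : Fin 3 → ℝ} (hz₀ : z₀ ∈ U) (h0 : f 2 0 z₀ = ε * f 0 0 z₀)
    (h1 : pd 0 (f 2 0) z₀ = ε * pd 0 (f 0 0) z₀) {z : Fin 3 → ℝ} (hz : z ∈ U) :
    f 2 0 z = ε * f 0 0 z ∧ pd 0 (f 2 0) z = ε * pd 0 (f 0 0) z := by
  have sm (i : Fin 3) : ContDiffOn ℝ ∞ (pd 0 (f i 0)) U := contDiffOn_pd S.isOpen (S.smooth i 0) 0
  have hne {z} (hz : z ∈ U) : pd 0 (f 0 0) z ^ 2 + pd 0 (f 2 0) z ^ 2 ≠ 0 := by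
    rcases S.nondeg z hz with h | h <;> positivity
  -- A function of the direction of (f₁₁', f₃₁') alone, hence constant by the vanishing Wronskian.
  -- The quotient f₃₁'/f₁₁' would not do, as f₁₁' might vanish away from z₀; the denominator of ψ
  -- cannot, by `nondeg`.
  set ψ : (Fin 3 → ℝ) → ℝ := fun z => (pd 0 (f 2 0) z - ε * pd 0 (f 0 0) z) ^ 2
    / (pd 0 (f 0 0) z ^ 2 + pd 0 (f 2 0) z ^ 2) with hψ
  have hψs : ContDiffOn ℝ ∞ ψ U :=
    (((sm 2).sub (contDiffOn_const.mul (sm 0))).pow 2).div (((sm 0).pow 2).add ((sm 2).pow 2))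
      (fun z hz => hne hz)
  have hψ0 : ∀ k, ∀ w ∈ U, pd k ψ w = 0 := by
    intro k w hw
    have L (i) := S.line_pd i 0 0 k hw
    have e := (hasDerivAt_line S.isOpen hψs hw k).unique
      ((((L 2).fun_sub ((L 0).const_mul ε)).fun_pow 2).fun_div
        (((L 0).fun_pow 2).fun_add ((L 2).fun_pow 2)) (by simpa using hne hw))
    rw [e]
    simp only [line_zero]
    have hWr : pd 0 (f 0 0) w * pd k (pd 0 (f 2 0)) w
        - pd 0 (f 2 0) w * pd k (pd 0 (f 0 0)) w = 0 := by
      fin_cases k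
      · exact S.wronskian_eq_zero hw
      · simp [S.pd1_pd_dx _ _ hw]
      · simp [S.pd2_pd_dx _ _ hw]
    rw [div_eq_zero_iff]
    left
    push_cast
    linear_combination 2 * (pd 0 (f 2 0) w - ε * pd 0 (f 0 0) w)
      * (pd 0 (f 0 0) w + ε * pd 0 (f 2 0) w) * hWr
  have hP {z} (hz : z ∈ U) : pd 0 (f 2 0) z = ε * pd 0 (f 0 0) z := by
    have h := eq_of_pd_eq_zero S.isOpen hUc hψs hψ0 hz hz₀
    simp only [hψ, h1, sub_self] at h
    rw [zero_pow two_ne_zero, zero_div, div_eq_zero_iff, or_iff_left (hne hz)] at h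
    exact sub_eq_zero.1 (pow_eq_zero_iff two_ne_zero |>.1 h)
  refine ⟨?_, hP hz⟩
  have hd : ContDiffOn ℝ ∞ (fun z => f 2 0 z - ε * f 0 0 z) U :=
    (S.smooth 2 0).sub (contDiffOn_const.mul (S.smooth 0 0))
  have h := eq_of_pd_eq_zero S.isOpen hUc hd (fun k w hw => by
    rw [(hasDerivAt_line S.isOpen hd hw k).unique
      ((S.line_f 2 0 k hw).fun_sub ((S.line_f 0 0 k hw).const_mul ε))]
    fin_cases k
    · exact sub_eq_zero.2 (hP hw)
    · simp [S.pd1_dx _ _ hw]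
    · simp [S.pd2_dx _ _ hw]) hz hz₀
  rw [h0, sub_self] at h
  exact sub_eq_zero.1 h

/-- The equations for which the second fundamental form can depend on a jet of finite order. -/
theorem StructureIdentities.isExceptional (S : StructureIdentities η U f F) (hη : η ≠ 0)
    (hUc : IsConnected U) (H : IsSecondFundamentalForm U f F W a b c) :
    IsExceptional η U f F := by
  obtain ⟨z₀, hz₀, ε, hε, h0, h1⟩ := H.exists_sign S hη
  have h31 {z} (hz : z ∈ U) := S.f31_eq hUc hz₀ h0 h1 hz
  have hp0 {z} (hz : z ∈ U) : pd 0 (f 0 0) z ≠ 0 := by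
    intro h
    rcases S.nondeg z hz with h' | h'
    · exact h' h
    · exact h' (by rw [(h31 hz).2, h, mul_zero])
  have hf22 {z} (hz : z ∈ U) : pd 0 (f 1 1) z = 0 := by
    rw [S.pd0_f22 hz, (h31 hz).1, (h31 hz).2]
    ring
  have hlam {z} (hz : z ∈ U) : f 1 1 z = f 1 1 z₀ :=
    eq_of_pd_eq_zero S.isOpen hUc (S.smooth 1 1) (fun k w hw => by
      fin_cases k
      · exact hf22 hw
      · exact S.pd1_f22 hw
      · exact S.pd2_dt 1 w hw) hz hz₀
  -- Since f₂₂' = 0, f₁₁(f₃₂ − εf₁₂) = 0. So f₁₁ vanishes on the open set where the second factor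
  -- does not, against f₁₁' ≠ 0.
  have h32 {z} (hz : z ∈ U) : f 2 1 z = ε * f 0 1 z := by
    by_contra hne
    set V := U ∩ {z | f 2 1 z - ε * f 0 1 z ≠ 0}
    have hV : IsOpen V := ((S.smooth 2 1).sub (contDiffOn_const.mul (S.smooth 0 1))).continuousOn
      |>.isOpen_inter_preimage S.isOpen isOpen_ne
    refine hp0 hz (pd_eq_zero_of_eqOn_const hV (c := 0) (fun w hw => ?_)
      ⟨hz, sub_ne_zero.2 hne⟩ 0)
    have h := S.pd0_f22_mul hw.1
    rw [hf22 hw.1, (h31 hw.1).1] at h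
    exact mul_left_cancel₀ hw.2 (by linear_combination -h)
  refine ⟨ε, f 1 1 z₀, hε, fun z hz => ⟨S.f21 z hz, hlam hz, (h31 hz).1, h32 hz, S.pd1_dx 0 z hz,
    S.pd2_dx 0 z hz, S.pd2_dt 0 z hz, hp0 hz, ?_, ?_⟩⟩
  · rw [S.pd1_f12 hz]
    exact mul_ne_zero (hp0 hz) (S.pd_F_ne z hz)
  · have h := S.eq₁ z hz
    rw [(h31 hz).1, h32 hz, hlam hz] at h
    have hp := hp0 hz
    field_simp
    linear_combination -h

/-- The linear form `η x + λ t` on the jet space. -/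
def phase (m : ℕ) (η lam : ℝ) : JetSpace m →L[ℝ] ℝ :=
  η • ContinuousLinearMap.fst ℝ ℝ (ℝ × (Fin (3 + m) → ℝ))
    + lam • (ContinuousLinearMap.fst ℝ ℝ (Fin (3 + m) → ℝ)).comp
      (ContinuousLinearMap.snd ℝ ℝ (ℝ × (Fin (3 + m) → ℝ)))

lemma phase_apply (η lam : ℝ) (q : JetSpace m) : phase m η lam q = η * q.1 + lam * q.2.1 := by
  simp [phase]

/-- The x-derivatives come from `codazzi_pd1` with L = 0. The first Codazzi equation is then affine
in f₁₁ with coefficients free of z₀, and f₁₁' ≠ 0 splits it into two equations for a_t and b_t. -/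
lemma exceptional_fderiv (S : StructureIdentities η U f F) (hη : η ≠ 0)
    (H : IsSecondFundamentalForm U f F W a b c) {ε lam : ℝ}
    (h11 : ∀ z ∈ U, f 1 1 z = lam) (h20 : ∀ z ∈ U, f 2 0 z = ε * f 0 0 z)
    (h21 : ∀ z ∈ U, f 2 1 z = ε * f 0 1 z) {q : JetSpace m} (hq : q ∈ W) :
    fderiv ℝ a q = (ε * (a q - c q)) • phase m η lam ∧
    fderiv ℝ b q = (2 * ε * b q) • phase m η lam := by
  have hp20 {q} (hq : q ∈ W) : pd 0 (f 2 0) (base q) = ε * pd 0 (f 0 0) (base q) :=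
    deriv_eq_of_line S.isOpen (H.base_mem q hq) (S.line_f 2 0 0 (H.base_mem q hq))
      ((S.line_f 0 0 0 (H.base_mem q hq)).const_mul ε) (fun s hs => h20 _ hs)
  have hx {q} (hq : q ∈ W) : fderiv ℝ a q (1, 0, 0) = ε * (a q - c q) * η ∧
      fderiv ℝ b q (1, 0, 0) = 2 * ε * b q * η := by
    obtain ⟨A1, A2⟩ := H.codazzi_pd1 S hη hq
    have hp := H.pd0_f11_ne S hη hq
    rw [wronskian, hp20 hq, h20 _ (H.base_mem q hq)] at A1 A2
    exact ⟨mul_left_cancel₀ hp (by linear_combination A1),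
      mul_left_cancel₀ hp (by linear_combination A2)⟩
  have hE {q} (hq : q ∈ W) : -f 0 0 (base q) * fderiv ℝ a q (0, 1, 0)
      + 2 * ε * b q * η * lam - η * fderiv ℝ b q (0, 1, 0)
      + (a q - c q) * ε * lam * f 0 0 (base q) = 0 := by
    have hz := H.base_mem q hq
    have h := H.codazzi₁_reduced S hη hq
    rw [(hx hq).1, (hx hq).2, h11 _ hz, h20 _ hz, h21 _ hz] at h
    linear_combination h
  have hv := fun q hq k => H.vert_eq_zero S hη (q := q) hq k
  have va := fun q hq k => (hv q hq k).1
  have vb := fun q hq k => (hv q hq k).2.1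
  have vc := fun q hq k => (hv q hq k).2.2
  have B := hasDerivAt_base S (H.base_mem q hq) 0 0 0
  have fa := hasDerivAt_line_const H.isOpen H.smooth_a va hq (0 : Fin 3)
  have fb := hasDerivAt_line_const H.isOpen H.smooth_b vb hq (0 : Fin 3)
  have fc := hasDerivAt_line_const H.isOpen H.smooth_c vc hq (0 : Fin 3)
  have ga := hasDerivAt_line_fderiv_const H.isOpen H.smooth_a va hq (0 : Fin 3) (0, 1, 0)
  have gb := hasDerivAt_line_fderiv_const H.isOpen H.smooth_b vb hq (0 : Fin 3) (0, 1, 0)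
  have e := deriv_eq_of_vertLine H.isOpen hq _
    ((((B.fun_neg.fun_mul ga).fun_add
      ((((fb.const_mul (2 * ε)).mul_const η).mul_const lam))).fun_sub (gb.const_mul η)).fun_add
      ((((fa.fun_sub fc).mul_const ε).mul_const lam).fun_mul B))
    (hasDerivAt_const (0 : ℝ) (0 : ℝ)) (fun s hs => hE hs)
  simp only [zero_smul, add_zero] at e
  have hat : fderiv ℝ a q (0, 1, 0) = ε * (a q - c q) * lam :=
    mul_left_cancel₀ (H.pd0_f11_ne S hη hq) (by linear_combination -e)
  have hbt : fderiv ℝ b q (0, 1, 0) = 2 * ε * b q * lam := by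
    have h := hE hq
    rw [hat] at h
    exact mul_left_cancel₀ hη (by linear_combination -h)
  constructor
  · refine ContinuousLinearMap.ext fun v => ?_
    rw [fderiv_jet_eq (va q hq), (hx hq).1, hat, smul_apply, phase_apply, smul_eq_mul]
    ring
  · refine ContinuousLinearMap.ext fun v => ?_
    rw [fderiv_jet_eq (vb q hq), (hx hq).2, hbt, smul_apply, phase_apply, smul_eq_mul]
    ring

lemma hasFDerivAt_exp_phase (κ η lam : ℝ) (q : JetSpace m) :
    HasFDerivAt (fun p : JetSpace m => Real.exp (κ * phase m η lam p))
      ((κ * Real.exp (κ * phase m η lam q)) • phase m η lam) q := by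
  have h := (((phase m η lam).hasFDerivAt (x := q)).const_mul κ).exp
  exact h.congr_fderiv (by rw [smul_smul, mul_comm])

/-- For the exceptional equations, the second fundamental form is universal. -/
theorem isUniversal_of_exceptional (S : StructureIdentities η U f F) (hη : η ≠ 0)
    (H : IsSecondFundamentalForm U f F W a b c) {ε lam : ℝ} (hε : ε * ε = 1)
    (h11 : ∀ z ∈ U, f 1 1 z = lam) (h20 : ∀ z ∈ U, f 2 0 z = ε * f 0 0 z)
    (h21 : ∀ z ∈ U, f 2 1 z = ε * f 0 1 z) : IsUniversal W a b c := by
  have hd {q} (hq : q ∈ W) := exceptional_fderiv S hη H h11 h20 h21 hq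
  have Ha {q} (hq : q ∈ W) : HasFDerivAt a ((ε * (a q - c q)) • phase m η lam) q :=
    (hd hq).1 ▸ (differentiableAt_of_smooth H.isOpen H.smooth_a hq).hasFDerivAt
  have Hb {q} (hq : q ∈ W) : HasFDerivAt b ((2 * ε * b q) • phase m η lam) q :=
    (hd hq).2 ▸ (differentiableAt_of_smooth H.isOpen H.smooth_b hq).hasFDerivAt
  obtain ⟨q₀, hq₀⟩ := H.isConnected.nonempty
  have const {g : JetSpace m → ℝ} (hg : ∀ q ∈ W, HasFDerivAt g (0 : JetSpace m →L[ℝ] ℝ) q) {q}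
      (hq : q ∈ W) : g q = g q₀ :=
    H.isOpen.is_const_of_fderiv_eq_zero (𝕜 := ℝ) H.isConnected.isPreconnected
      (fun p hp => (hg p hp).differentiableAt.differentiableWithinAt)
      (fun p hp => (hg p hp).fderiv) hq hq₀
  set e : JetSpace m → ℝ := fun q => Real.exp (-2 * ε * phase m η lam q) with he
  have He (q : JetSpace m) : HasFDerivAt e ((-2 * ε * e q) • phase m η lam) q :=
    hasFDerivAt_exp_phase (-2 * ε) η lam q
  -- Vanishing jet derivatives alone would not give functions of (x, t) on W, whose fibres over (x,
  -- t) may be disconnected. First integrals are constant on the connected W itself. With θ = ηx +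
  -- λt, the first is b·exp(−2εθ).
  have hb {q} (hq : q ∈ W) := const (g := fun q => b q * e q) (fun q hq => by
    refine ((Hb hq).fun_mul (He q)).congr_fderiv ?_
    ext v <;> simp <;> ring) hq
  -- By Gauss, d(a²) = 2ε(a² − ac)dθ = 2ε(a² − b² + 1)dθ, and d(b²) = 4εb²dθ. Hence a² + b² + 1 also
  -- scales like exp(2εθ).
  have hl {q} (hq : q ∈ W) := const (g := fun q => (a q * a q + b q * b q + 1) * e q)
    (fun q hq => by
      refine (((((Ha hq).fun_mul (Ha hq)).fun_add ((Hb hq).fun_mul (Hb hq))).add_const 1).fun_mul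
        (He q)).congr_fderiv ?_
      refine ContinuousLinearMap.ext fun v => ?_
      simp only [add_apply, smul_apply, smul_eq_mul, zero_apply]
      linear_combination (-2 * ε * e q * phase m η lam v) * H.gauss q hq) hq
  generalize b q₀ * e q₀ = γ at hb
  generalize (a q₀ * a q₀ + b q₀ * b q₀ + 1) * e q₀ = l at hl
  have hb' {q} (hq : q ∈ W) : b q = γ * Real.exp (2 * ε * phase m η lam q) := by
    rw [← hb hq, he, mul_assoc, ← Real.exp_add]
    simp
  have ha' {q} (hq : q ∈ W) :
      a q ^ 2 = l * Real.exp (2 * ε * phase m η lam q) - b q ^ 2 - 1 := by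
    rw [← hl hq, he, mul_assoc, ← Real.exp_add]
    simp
    ring
  -- At a zero of a, Gauss gives b² = 1 and its derivative gives c² = −4b². So a keeps one sign on
  -- the connected W, and a² determines a.
  have hne {q} (hq : q ∈ W) : a q ≠ 0 := by
    intro h0
    have hg := H.gauss q hq
    have hg' := H.gauss_fderiv hq (1, 0, 0)
    rw [(hd hq).1, (hd hq).2, smul_apply, smul_apply, phase_apply, h0] at hg'
    rw [h0] at hg
    have h1 : c q ^ 2 + 4 = 0 := by
      have hεη : ε * η ≠ 0 := mul_ne_zero (fun h => by rw [h] at hε; simp at hε) hη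
      refine mul_left_cancel₀ hεη ?_
      simp only [smul_eq_mul] at hg'
      linear_combination -hg' + 4 * ε * η * hg
    nlinarith [sq_nonneg (c q)]
  have hc {q} (hq : q ∈ W) : c q = (b q ^ 2 - 1) / a q := by
    rw [eq_div_iff (hne hq)]
    linear_combination H.gauss q hq
  have hsign : ∃ σ : ℝ, ∀ q ∈ W, a q = σ * √(a q ^ 2) := by
    have hconn : IsPreconnected W := H.isConnected.isPreconnected
    rcases lt_or_gt_of_ne (hne hq₀) with h0 | h0
    · refine ⟨-1, fun q hq => ?_⟩
      have : a q ≤ 0 := by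
        by_contra! hpos
        obtain ⟨p, hp, hp0⟩ := hconn.intermediate_value hq₀ hq H.smooth_a.continuousOn
          ⟨h0.le, hpos.le⟩
        exact hne hp hp0
      rw [Real.sqrt_sq_eq_abs, abs_of_nonpos this]
      ring
    · refine ⟨1, fun q hq => ?_⟩
      have : 0 ≤ a q := by
        by_contra! hneg
        obtain ⟨p, hp, hp0⟩ := hconn.intermediate_value hq hq₀ H.smooth_a.continuousOn
          ⟨hneg.le, h0.le⟩
        exact hne hp hp0
      rw [Real.sqrt_sq_eq_abs, abs_of_nonneg this]
      ring
  obtain ⟨σ, hσ⟩ := hsign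
  let E : ℝ → ℝ → ℝ := fun x t => Real.exp (2 * ε * (η * x + lam * t))
  let B : ℝ → ℝ → ℝ := fun x t => γ * E x t
  let A : ℝ → ℝ → ℝ := fun x t => σ * √(l * E x t - B x t ^ 2 - 1)
  refine ⟨A, B, fun x t => (B x t ^ 2 - 1) / A x t, fun q hq => ?_⟩
  have hB : b q = B q.1 q.2.1 := by rw [hb' hq, phase_apply]
  have hA : a q = A q.1 q.2.1 := by
    rw [hσ q hq, ha' hq, phase_apply, hB]
  exact ⟨hA, hB, by rw [hc hq, hA, hB]⟩

/-- For the exceptional equations, second fundamental forms depending on `(x, t)` exist locally. -/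
theorem exists_isSecondFundamentalForm (S : StructureIdentities η U f F) {ε lam : ℝ}
    (h11 : ∀ z ∈ U, f 1 1 z = lam) (h20 : ∀ z ∈ U, f 2 0 z = ε * f 0 0 z)
    (h21 : ∀ z ∈ U, f 2 1 z = ε * f 0 1 z) {q₀ : JetSpace m} (hq₀ : base q₀ ∈ U) :
    ∃ (W : Set (JetSpace m)) (a b c : JetSpace m → ℝ), q₀ ∈ W ∧
      IsSecondFundamentalForm U f F W a b c := by
  set s₀ := phase m η lam q₀
  -- The solution with b = 0, a² = g, c = −1/a. The first integral is normalised so that g = 1 at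
  -- the given point.
  set g : JetSpace m → ℝ :=
    fun q => 2 * Real.exp (-(2 * ε * s₀)) * Real.exp (2 * ε * phase m η lam q) - 1 with hg
  have hgs : ContDiff ℝ ∞ g := by fun_prop
  have hg' (q : JetSpace m) : HasFDerivAt g ((2 * ε * (g q + 1)) • phase m η lam) q := by
    refine (((hasFDerivAt_exp_phase (2 * ε) η lam q).const_mul _).sub_const 1).congr_fderiv ?_
    rw [smul_smul]
    congr 1
    simp only [hg]
    ring
  have hO : IsOpen ({q | 0 < g q} ∩ base ⁻¹' U) :=
    (isOpen_lt continuous_const hgs.continuous).inter (S.isOpen.preimage continuous_base)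
  have hq₀O : q₀ ∈ {q | 0 < g q} ∩ base ⁻¹' U := by
    refine ⟨?_, hq₀⟩
    simp only [Set.mem_ofPred_eq, hg]
    rw [mul_assoc, ← Real.exp_add]
    norm_num [s₀]
  obtain ⟨r, hr, hball⟩ := Metric.isOpen_iff.1 hO q₀ hq₀O
  set W := Metric.ball q₀ r
  have hpos {q} (hq : q ∈ W) : 0 < g q := (hball hq).1
  have hbU {q} (hq : q ∈ W) : base q ∈ U := (hball hq).2
  set a : JetSpace m → ℝ := fun q => √(g q) with ha
  have hane {q} (hq : q ∈ W) : a q ≠ 0 := (Real.sqrt_pos.2 (hpos hq)).ne'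
  have hsq {q} (hq : q ∈ W) : a q ^ 2 = g q := Real.sq_sqrt (hpos hq).le
  have has : ContDiffOn ℝ ∞ a W := hgs.contDiffOn.sqrt (fun q hq => (hpos hq).ne')
  have Ha {q} (hq : q ∈ W) : HasFDerivAt a ((ε * (a q + (a q)⁻¹)) • phase m η lam) q := by
    refine ((hg' q).sqrt (hpos hq).ne').congr_fderiv ?_
    rw [smul_smul]
    congr 1
    rw [show √(g q) = a q from rfl, ← hsq hq]
    have := hane hq
    field_simp
  set c : JetSpace m → ℝ := fun q => -(a q)⁻¹ with hc
  have hcs : ContDiffOn ℝ ∞ c W := (has.inv (fun q hq => hane hq)).neg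
  -- The value of κ is irrelevant: ω² = dθ, so d(cω²) = 0 for any c depending on θ only, while ω¹ ∧
  -- ω³ = 0 as ω³ = εω¹. This is the second Codazzi equation for b = 0.
  have Hc {q} (hq : q ∈ W) : ∃ κ : ℝ, HasFDerivAt c (κ • phase m η lam) q := by
    have h := ((hasDerivAt_inv (hane hq)).comp_hasFDerivAt q (Ha hq)).neg
    rw [smul_smul, ← neg_smul] at h
    exact ⟨_, h⟩
  have Hb (q : JetSpace m) : HasFDerivAt (fun _ : JetSpace m => (0 : ℝ))
      (0 : JetSpace m →L[ℝ] ℝ) q := hasFDerivAt_const 0 q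
  have dx {g : JetSpace m → ℝ} {κ x t : ℝ} {Z : ℕ → ℝ}
      (h : HasFDerivAt g (κ • phase m η lam) (jetPoint m x t Z)) :
      Dx g x t Z = κ * η ∧ Dt F g x t Z = κ * lam := by
    rw [jetPoint] at h
    rw [Dx, Dt, h.fderiv]
    simp [phase_apply]
  have db (x t : ℝ) (Z : ℕ → ℝ) : Dx (fun _ : JetSpace m => (0 : ℝ)) x t Z = 0 ∧
      Dt F (fun _ : JetSpace m => (0 : ℝ)) x t Z = 0 := by
    rw [Dx, Dt]
    simp
  refine ⟨W, a, fun _ => 0, c, Metric.mem_ball_self hr, Metric.isOpen_ball,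
    (convex_ball q₀ r).isConnected ⟨q₀, Metric.mem_ball_self hr⟩, fun q hq => hbU hq, has,
    contDiffOn_const, hcs, ?_, ?_, ?_⟩
  · intro q hq
    have := hane hq
    simp only [hc]
    field_simp
    ring
  · intro x t Z hq
    change jetPoint m x t Z ∈ W at hq
    have hz : res 3 Z ∈ U := hbU hq
    have hbase : base ((x, t, res (3 + m) Z) : JetSpace m) = res 3 Z := rfl
    have hca : c (jetPoint m x t Z) = -(a (jetPoint m x t Z))⁻¹ := rfl
    obtain ⟨d1, d2⟩ := dx (Ha hq)
    have h := totalD_combination S hz (Ha hq).differentiableAt (Hb _).differentiableAt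
    rw [(db x t Z).1, (db x t Z).2, d1, d2, h20 _ hz, h21 _ hz, h11 _ hz] at h
    rw [h]
    simp only [wedge, hbase, S.f21 _ hz, h20 _ hz, h21 _ hz, h11 _ hz]
    change _ = -((0 * f 0 0 (res 3 Z) + c (jetPoint m x t Z) * η) * (ε * f 0 1 (res 3 Z))
      - (0 * f 0 1 (res 3 Z) + c (jetPoint m x t Z) * lam) * (ε * f 0 0 (res 3 Z)))
    rw [hca]
    ring
  · intro x t Z hq
    change jetPoint m x t Z ∈ W at hq
    have hz : res 3 Z ∈ U := hbU hq
    have hbase : base ((x, t, res (3 + m) Z) : JetSpace m) = res 3 Z := rfl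
    obtain ⟨κ, hκ⟩ := Hc hq
    obtain ⟨d1, d2⟩ := dx hκ
    have h := totalD_combination S hz (Hb _).differentiableAt hκ.differentiableAt
    rw [(db x t Z).1, (db x t Z).2, d1, d2, h20 _ hz, h21 _ hz, h11 _ hz] at h
    rw [h]
    simp only [wedge, hbase, S.f21 _ hz, h20 _ hz, h21 _ hz, h11 _ hz]
    ring

end

end PseudoSpherical

end

theorem theorem1 (η : ℝ) (hη : η ≠ 0) (U : Set (Fin 3 → ℝ)) (hU : IsOpen U) (hUc : IsConnected U)
    (F : (Fin 3 → ℝ) → ℝ) (hF : ContDiffOn ℝ ∞ F U)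
    (hF2 : ∀ z ∈ U, PseudoSpherical.pd 2 F z ≠ 0)
    (f : PseudoSpherical.Coeffs) (hf : ∀ i j, ContDiffOn ℝ ∞ (f i j) U) :
    (PseudoSpherical.DescribesPSS η U f F →
      (∃ (m : ℕ) (W : Set (PseudoSpherical.JetSpace m)) (a b c : PseudoSpherical.JetSpace m → ℝ),
        PseudoSpherical.IsSecondFundamentalForm U f F W a b c) →
      PseudoSpherical.IsExceptional η U f F) ∧
    (PseudoSpherical.IsExceptional η U f F →
      PseudoSpherical.DescribesPSS η U f F ∧
      ∀ (x t : ℝ), ∀ z ∈ U,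
        ∃ (W : Set (PseudoSpherical.JetSpace 0)) (a b c : PseudoSpherical.JetSpace 0 → ℝ),
          (x, t, z) ∈ W ∧ PseudoSpherical.IsSecondFundamentalForm U f F W a b c) ∧
    (PseudoSpherical.IsExceptional η U f F →
      ∀ (m : ℕ) (W : Set (PseudoSpherical.JetSpace m)) (a b c : PseudoSpherical.JetSpace m → ℝ),
        PseudoSpherical.IsSecondFundamentalForm U f F W a b c →
        PseudoSpherical.IsUniversal W a b c) := by
  refine ⟨fun hD ⟨m, W, a, b, c, H⟩ =>
    (hD.structureIdentities hU hF hF2 hf).isExceptional hη hUc H, fun hE => ?_,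
    fun hE m W a b c H => ?_⟩
  · have hD := hE.describesPSS hη hU hf
    have S := hD.structureIdentities hU hF hF2 hf
    obtain ⟨ε, lam, hε, h⟩ := hE
    exact ⟨hD, fun x t z hz => PseudoSpherical.exists_isSecondFundamentalForm S
      (fun z hz => (h z hz).2.1) (fun z hz => (h z hz).2.2.1)
      (fun z hz => (h z hz).2.2.2.1) (m := 0) (q₀ := (x, t, z)) hz⟩
  · have S := (hE.describesPSS hη hU hf).structureIdentities hU hF hF2 hf
    obtain ⟨ε, lam, hε, h⟩ := hE
    exact PseudoSpherical.isUniversal_of_exceptional S hη H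
      (by rcases hε with rfl | rfl <;> norm_num) (fun z hz => (h z hz).2.1)
      (fun z hz => (h z hz).2.2.1) (fun z hz => (h z hz).2.2.2.1)
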